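/- Let $n\ge 2$ and $r\ge 0$ be integers with $r+1<n$, and put $q=\frac{n-r-1}{r+1}>0$. Let $\mathbb H^n$ be the ball model $\{x\in\mathbb R^n:|x|<1\}$ with metric $\frac{4|dx|^2}{(1-|x|^2)^2}$ and give $\mathbb H^n\times\mathbb R$ the product metric. A hypersurface is called $r$-minimal if $H_{r+1}=0$, where $\binom{n}{r+1}H_{r+1}$ is the $(r+1)$-st elementary symmetric function of its principal curvatures. A rotational hypersurface (with axis $\{0\}\times\mathbb R$) is one parametrized by $(t,\zeta)\mapsto(\tanh(f(t)/2)\,\zeta,\,t)$, $\zeta\in S^{n-1}$, $t$ in an interval, with $f$ a smooth positive function; below the interval is compact, $[c,d]$ with $c<d$, and the boundary is the image of $\{c,d\}\times S^{n-1}$. For $a>0$ let $f(a,\cdot):I_a\to(0,\infty)$ be the maximal solution of $$f''=q\coth(f)\,(1+f'^2),\qquad f(0)=a,\quad f'(0)=0,$$ and let $\mathcal M_a(r)=\{(\tanh(f(a,t)/2)\zeta,t): t\in I_a,\ \zeta\in S^{n-1}\}$ be the $r$-catenoid it generates. For $0<a\le\rho$ put $$\lambda(a,\rho)=\sinh^q(a)\int_a^\rho\frac{du}{\sqrt{\sinh^{2q}(u)-\sinh^{2q}(a)}}.$$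 If $q\ge1$ let $J_q=(0,\infty)$ and $T=\frac{\pi}{2q}=\frac{\pi(r+1)}{2(n-r-1)}$. If $q<1$ let $M=\operatorname{arcosh}\sqrt{1/(1-q)}$, $J_q=(0,M]$ and $T=\max_{0<a<M}\lambda(a,M)$. Let $t_0\in(0,T)$. Then, on the set of those $a>0$ for which $t_0\in I_a$, the function $a\mapsto f(a,t_0)$ attains its minimum $m_0$ at a unique point $a_0$. For $R>0$ let $D_\pm(R)$ be the $(n-1)$-sphere of hyperbolic radius $R$ in the slice $t=\pm t_0$ with centre on the axis. Then: (1) If $R<m_0$, there is no $r$-minimal rotational hypersurface with boundary $D_+(R)\cup D_-(R)$. (2) If $R=m_0$, there is exactly one $r$-minimal rotational hypersurface with boundary $D_+(R)\cup D_-(R)$, namely the part of $\mathcal M_{a_0}(r)$ in the slab $|t|\le t_0$. (3) If $R\in J_q$ and $R>m_0$, there are $a_1<a_0<a_2$ with $f(a_1,t_0)=f(a_2,t_0)=R$; and for all such $a_1,a_2$ the parts of $\mathcal M_{a_1}(r)$ and $\mathcal M_{a_2}(r)$ in the slab $|t|\le t_0$ are two distinct $r$-minimal rotational hypersurfaces with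 boundary $D_+(R)\cup D_-(R)$. In particular there are at least two. -/

import Mathlib

open scoped Manifold ContDiff

noncomputable section

namespace HypRot

/-! The ambient space is the product of the ball model of hyperbolic `n`-space with the line;
throughout `n = m + 1`, and the ball is the open unit ball of `EuclideanSpace ℝ (Fin (m + 1))`. -/

/-- The coordinate space in which `ℍⁿ × ℝ` (ball model times the line) is an open set. -/
abbrev Coord (m : ℕ) : Type := EuclideanSpace ℝ (Fin (m + 1)) × ℝ

/-- The region of `Coord m` occupied by `ℍⁿ × ℝ`: open unit ball times `ℝ`. -/
def ambient (m : ℕ) : Set (Coord m) := {p | ‖p.1‖ < 1}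

/-- The product metric `4 |dx|² / (1 - |x|²)² + dt²` at the point `p`, on tangent vectors `u`, `v`. -/
def metric {m : ℕ} (p u v : Coord m) : ℝ :=
  (2 / (1 - ‖p.1‖ ^ 2)) ^ 2 * inner ℝ u.1 v.1 + u.2 * v.2

/-- The derivative in the direction `w`, at `p`, of the coefficient `q ↦ g_q(u, v)` of the metric
(with `u`, `v` constant in the coordinates). -/
def metricDeriv {m : ℕ} (p w u v : Coord m) : ℝ :=
  fderiv ℝ (fun q : Coord m => metric q u v) p w

/-- `g(Γ_p(u, v), w)`, where `Γ` denotes the Christoffel symbols of the Levi-Civita connection in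
the given coordinates: `2 g(Γ(u, v), w) = (∂_u g)(v, w) + (∂_v g)(u, w) - (∂_w g)(u, v)`. -/
def christoffel {m : ℕ} (p u v w : Coord m) : ℝ :=
  (metricDeriv p u v w + metricDeriv p v u w - metricDeriv p w u v) / 2

/-- The hyperbolic distance in the ball model. -/
def hypDist {m : ℕ} (x y : EuclideanSpace ℝ (Fin (m + 1))) : ℝ :=
  Real.arcosh (1 + 2 * ‖x - y‖ ^ 2 / ((1 - ‖x‖ ^ 2) * (1 - ‖y‖ ^ 2)))

section Immersions

variable {m : ℕ} {V : Type*} [NormedAddCommGroup V] [NormedSpace ℝ V]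
  {H : Type*} [TopologicalSpace H] {S : Type*} [TopologicalSpace S] [ChartedSpace H S]

/-- The differential at `p` of a map from a manifold `S` modelled on `V` to `Coord m`; the tangent
space of `S` at `p` is identified with `V`. -/
def diff (I : ModelWithCorners ℝ V H) (X : S → Coord m) (p : S) : V →L[ℝ] Coord m :=
  mfderiv I 𝓘(ℝ, Coord m) X p

/-- The vector `N p` is a unit normal of the immersion `X` at `p`. -/
def IsUnitNormalAt (I : ModelWithCorners ℝ V H) (X N : S → Coord m) (p : S) : Prop :=
  metric (X p) (N p) (N p) = 1 ∧ ∀ v : V, metric (X p) (N p) (diff I X p v) = 0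

/-- The second fundamental form `II(u, v) = -⟨∇_u N, dX(v)⟩` of the immersion `X` with unit normal
field `N`, where `∇` is the Levi-Civita connection of `ℍⁿ × ℝ` (pulled back along `X`). -/
def secondFundamentalForm (I : ModelWithCorners ℝ V H) (X N : S → Coord m) (p : S) (u v : V) : ℝ :=
  -(metric (X p) (diff I N p u) (diff I X p v)
    + christoffel (X p) (diff I X p u) (N p) (diff I X p v))

/-- `A` is the linear operator associated with the second fundamental form through the metric
induced by `X`. -/
def IsShapeOperatorAt (I : ModelWithCorners ℝ V H) (X N : S → Coord m) (p : S) (A : V →ₗ[ℝ] V) :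
    Prop :=
  ∀ u v : V,
    metric (X p) (diff I X p (A u)) (diff I X p v) = secondFundamentalForm I X N p u v

/-- `H_k` of a hypersurface with shape operator `A`: the normalized `k`-th elementary symmetric
function of the eigenvalues of `A`, counted with multiplicity. -/
def meanCurvature (A : V →ₗ[ℝ] V) [FiniteDimensional ℝ V] (k : ℕ) : ℝ :=
  A.charpoly.roots.esymm k / (Module.finrank ℝ V).choose k

/-- `X` is a smooth two-sided immersed hypersurface of `ℍⁿ × ℝ` on the open set `U` of its source,
and it is `r`-minimal there: `H_{r+1} = 0`. -/
structure IsRMinimalImmersionOn [FiniteDimensional ℝ V] (I : ModelWithCorners ℝ V H) (r : ℕ)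
    (X : S → Coord m) (U : Set S) : Prop where
  smooth : ContMDiffOn I 𝓘(ℝ, Coord m) ∞ X U
  mapsTo : Set.MapsTo X U (ambient m)
  immersion : ∀ p ∈ U, Function.Injective (diff I X p)
  rMinimal : ∃ N : S → Coord m, ContMDiffOn I 𝓘(ℝ, Coord m) ∞ N U ∧
    ∀ p ∈ U, IsUnitNormalAt I X N p ∧
      ∃ A : V →ₗ[ℝ] V, IsShapeOperatorAt I X N p A ∧ meanCurvature A (r + 1) = 0

end Immersions

/-- The unit sphere `S^{n-1}`, `n = m + 1`. -/
abbrev USphere (m : ℕ) : Type := Metric.sphere (0 : EuclideanSpace ℝ (Fin (m + 1))) 1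

/-- The rotation parametrization `(t, ζ) ↦ (tanh (f(t)/2) ζ, t)`. -/
def rotParam (m : ℕ) (f : ℝ → ℝ) (p : ℝ × USphere m) : Coord m :=
  (Real.tanh (f p.1 / 2) • (p.2 : EuclideanSpace ℝ (Fin (m + 1))), p.1)

/-- `M` is a (compact, connected) `r`-minimal rotational hypersurface of `ℍⁿ × ℝ` with axis
`{0} × ℝ` and with boundary `B`: it is generated by a smooth positive function `f` on a compact
interval `[c, d]`. -/
def IsRMinimalRotational (m r : ℕ) (M B : Set (Coord m)) : Prop :=
  ∃ (c d : ℝ) (f : ℝ → ℝ), c < d ∧ ContDiffOn ℝ ∞ f (Set.Icc c d) ∧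
    (∀ t ∈ Set.Icc c d, 0 < f t) ∧
    M = rotParam m f '' (Set.Icc c d ×ˢ Set.univ) ∧
    B = rotParam m f '' ({c, d} ×ˢ Set.univ) ∧
    IsRMinimalImmersionOn (𝓘(ℝ, ℝ).prod (𝓡 m)) r (rotParam m f) (Set.Ioo c d ×ˢ Set.univ)

/-- The `(n-1)`-sphere of (hyperbolic) radius `R` in the slice at height `s`, centred on the axis. -/
def coaxialSphere (m : ℕ) (R s : ℝ) : Set (Coord m) :=
  {p | p ∈ ambient m ∧ hypDist p.1 0 = R ∧ p.2 = s}

/-- `q = (n - r - 1) / (r + 1)`. -/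
def qExp (n r : ℕ) : ℝ := ((n : ℝ) - r - 1) / (r + 1)

/-- `f` is, on the open interval `J` around `0`, a positive solution of the Cauchy problem
`f'' = q coth(f) (1 + f'²)`, `f(0) = a`, `f'(0) = 0`. -/
structure IsProfileSolution (q a : ℝ) (J : Set ℝ) (f : ℝ → ℝ) : Prop where
  isOpen : IsOpen J
  ordConnected : J.OrdConnected
  zero_mem : (0 : ℝ) ∈ J
  pos : ∀ t ∈ J, 0 < f t
  differentiable : ∀ t ∈ J, DifferentiableAt ℝ f t
  ode : ∀ t ∈ J, HasDerivAt (deriv f)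
    (q * (Real.cosh (f t) / Real.sinh (f t)) * (1 + deriv f t ^ 2)) t
  init : f 0 = a
  init_deriv : deriv f 0 = 0

/-- The interval `I_a` of the maximal solution of the Cauchy problem. -/
def profileDomain (q a : ℝ) : Set ℝ := {t | ∃ J f, IsProfileSolution q a J f ∧ t ∈ J}

open Classical in
/-- The maximal solution `t ↦ f(a, t)` of the Cauchy problem (with value `0` off `I_a`): at `t` it
is the value of any solution whose interval contains `t`. -/
def profile (q a t : ℝ) : ℝ :=
  if h : ∃ f : ℝ → ℝ, ∃ J, IsProfileSolution q a J f ∧ t ∈ J then h.choose t else 0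

/-- The `r`-catenoid `M_a(r)`: the hypersurface generated by the maximal solution `f(a, ·)`. -/
def catenoid (m r : ℕ) (a : ℝ) : Set (Coord m) :=
  rotParam m (profile (qExp (m + 1) r) a) '' (profileDomain (qExp (m + 1) r) a ×ˢ Set.univ)

/-- The part of `M_a(r)` in the closed slab `|t| ≤ t₀`. -/
def catenoidPiece (m r : ℕ) (a t₀ : ℝ) : Set (Coord m) :=
  {p | p ∈ catenoid m r a ∧ |p.2| ≤ t₀}

/-- `λ(a, ρ)`, the height at which the profile curve of neck size `a` reaches distance `ρ` from the
axis, for `0 < a ≤ ρ`. -/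
def heightAt (q a ρ : ℝ) : ℝ :=
  Real.sinh a ^ q *
    ∫ u in a..ρ, 1 / Real.sqrt (Real.sinh u ^ (2 * q) - Real.sinh a ^ (2 * q))

/-- `M = arcosh √(1 / (1 - q))`, used for `q < 1`. -/
def critRadius (q : ℝ) : ℝ := Real.arcosh (Real.sqrt (1 / (1 - q)))

/-- `J_q = (0, ∞)` for `q ≥ 1` and `J_q = (0, M]` for `q < 1`. -/
def radiusRange (q : ℝ) : Set ℝ :=
  if 1 ≤ q then Set.Ioi 0 else Set.Ioc 0 (critRadius q)

/-- `T = π / (2q) = π (r + 1) / (2 (n - r - 1))` for `q ≥ 1`; for `q < 1`, `T` is the maximal value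
of `a ↦ λ(a, M)` on `(0, M)`. -/
def heightBound (q : ℝ) : ℝ :=
  if 1 ≤ q then Real.pi / (2 * q)
  else sSup ((fun a => heightAt q a (critRadius q)) '' Set.Ioo 0 (critRadius q))

/-- The domain of `a ↦ φ^{t₀}(a) = f(a, t₀)`: the neck sizes `a > 0` whose catenoid reaches the
height `t₀`. -/
def reaching (q t₀ : ℝ) : Set ℝ := {a | 0 < a ∧ t₀ ∈ profileDomain q a}

end HypRot

end

open HypRot

open scoped Manifold ContDiff

namespace HypRot

open Real Set Filter Topology MeasureTheory

/-! Let θ = arctan f' be the angle of a profile curve. The equation has the first integral sinh f ·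
(cos θ)^(1/q) = sinh a, and θ' = q coth f. Hence dt/dθ = (1/q) tanh f = (1/q)(1 + (cos θ)^(2/q) /
sinh² a)^(-1/2): the height is an integral over θ of a bounded continuous function, without the
endpoint singularity of λ. Inverting it gives existence, uniqueness, smoothness and the maximal
interval |t| < `maxHeight q a`. Composed with θ = arccos((sinh a / sinh y)^q) it becomes `reach q a
y`, which is jointly continuous, extends λ by 0 to y < a, and for t ≥ 0, y ≥ a inverts t ↦ f(a, t).

The minimum is unique because a ↦ f(a, t₀) is strictly midpoint convex (`lt_reach_midpoint`). Since
tanh is concave and (1 + p²)/g is convex, (x, p) ↦ coth x (1 + p²) is convex on x > 0. So the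
half-sum h of two solutions with necks a < b satisfies h'' ≥ q coth h (1 + h'²); its energy drops
below that of the catenoid with neck c = (a + b)/2, and h outgrows f(c, ·). A minimum exists because
`maxHeight q a` tends to 0 with a, while a ≤ f(a, t₀) (`exists_isLeast_profile`). If R > m₀, then
`reach q a R` exceeds t₀ at a = a₀ and is below t₀ for small a and for a = R, so it equals t₀ on
both sides of a₀ (`exists_profile_eq_of_lt`).

A rotational hypersurface has one principal curvature k₀ along the profile and n - 1 equal ones k ≠
0, so H_{r+1} = 0 iff k₀ = -q k, which is the profile equation
(`isRMinimalImmersionOn_rotParam_iff`). A generating function with equal boundary values has a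
critical point, hence is a translated profile, and the symmetry of the boundary makes the
translation zero (`exists_catenoidPiece_of_isRMinimalRotational`). The spanning hypersurfaces thus
correspond to the solutions a of f(a, t₀) = R. -/

/-! ### Height as a function of the angle of the profile curve -/

/-- Up to the factor `1 / q`, the speed `dt / dθ` of the height with respect to the angle `θ` of a
profile curve of neck size `a`, where `σ = 1 / sinh a`. -/
noncomputable def angleSpeed (q σ φ : ℝ) : ℝ := 1 / √(1 + σ ^ 2 * |cos φ| ^ (2 / q))

/-- The height at which the profile curve of neck size `a` makes the angle `θ` with the axis. -/
noncomputable def angleHeight (q a θ : ℝ) : ℝ := (1 / q) * ∫ φ in (0 : ℝ)..θ, angleSpeed q (sinh a)⁻¹ φ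

/-- The angle of the profile curve of neck size `a` at the distance `y` from the axis. -/
noncomputable def neckAngle (q a y : ℝ) : ℝ := arccos ((sinh a / sinh y) ^ q)

/-- The height at which the profile curve of neck size `a` reaches the distance `y`. -/
noncomputable def reach (q a y : ℝ) : ℝ := angleHeight q a (neckAngle q a y)

/-- The absolute value keeps the speed positive and continuous at every real angle, so the height
can be inverted on the whole line although profile curves only use |θ| < π/2. -/
lemma one_le_angleSpeed_arg (q σ φ : ℝ) : 1 ≤ 1 + σ ^ 2 * |cos φ| ^ (2 / q) := by
  have : 0 ≤ |cos φ| ^ (2 / q) := rpow_nonneg (abs_nonneg _) _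
  nlinarith [sq_nonneg σ, mul_nonneg (sq_nonneg σ) this]

lemma angleSpeed_pos (q σ φ : ℝ) : 0 < angleSpeed q σ φ := by
  have := one_le_angleSpeed_arg q σ φ
  unfold angleSpeed; positivity

lemma angleSpeed_le_one (q σ φ : ℝ) : angleSpeed q σ φ ≤ 1 := by
  have := one_le_angleSpeed_arg q σ φ
  unfold angleSpeed
  rw [div_le_one (by positivity)]
  exact Real.one_le_sqrt.2 this

lemma angleSpeed_ge {q : ℝ} (hq : 0 < q) (σ φ : ℝ) : 1 / √(1 + σ ^ 2) ≤ angleSpeed q σ φ := by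
  have := one_le_angleSpeed_arg q σ φ
  unfold angleSpeed
  apply one_div_le_one_div_of_le (by positivity)
  apply Real.sqrt_le_sqrt
  have h1 : |cos φ| ^ (2 / q) ≤ 1 := rpow_le_one (abs_nonneg _) (abs_cos_le_one φ) (by positivity)
  nlinarith [sq_nonneg σ]

lemma continuous_angleSpeed {q : ℝ} (hq : 0 < q) :
    Continuous (Function.uncurry (angleSpeed q)) := by
  have h1 : Continuous fun p : ℝ × ℝ => |cos p.2| ^ (2 / q) :=
    Continuous.rpow_const (by fun_prop) fun _ => Or.inr (by positivity)
  have h2 : Continuous fun p : ℝ × ℝ => 1 + p.1 ^ 2 * |cos p.2| ^ (2 / q) := by fun_prop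
  refine Continuous.div continuous_const h2.sqrt fun p => ?_
  have := one_le_angleSpeed_arg q p.1 p.2
  positivity

lemma continuous_angleSpeed_right {q : ℝ} (hq : 0 < q) (σ : ℝ) : Continuous (angleSpeed q σ) :=
  (continuous_angleSpeed hq).comp (by fun_prop : Continuous fun φ : ℝ => (σ, φ))

/-- This links the explicit integrand to the equation: along a profile curve the hypothesis is the
first integral, and the speed is then tanh of the distance to the axis. -/
lemma angleSpeed_eq {q a y φ : ℝ} (hq : 0 < q) (ha : 0 < a) (hy : 0 < y)
    (h : |cos φ| = (sinh a / sinh y) ^ q) :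
    angleSpeed q (sinh a)⁻¹ φ = sinh y / cosh y := by
  have hsa := sinh_pos_iff.2 ha
  have hsy := sinh_pos_iff.2 hy
  have hcy := cosh_pos y
  have h1 : |cos φ| ^ (2 / q) = (sinh a / sinh y) ^ 2 := by
    rw [h, ← rpow_mul (by positivity), mul_div_cancel₀ _ hq.ne']
    norm_num
  have h2 : 1 + (sinh a)⁻¹ ^ 2 * (sinh a / sinh y) ^ 2 = (cosh y / sinh y) ^ 2 := by
    have := cosh_sq y
    field_simp
    linarith
  rw [angleSpeed, h1, h2, Real.sqrt_sq (by positivity), one_div_div]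

lemma hasDerivAt_angleHeight {q : ℝ} (hq : 0 < q) (a θ : ℝ) :
    HasDerivAt (angleHeight q a) ((1 / q) * angleSpeed q (sinh a)⁻¹ θ) θ := by
  have hc := continuous_angleSpeed_right hq (sinh a)⁻¹
  exact (intervalIntegral.integral_hasDerivAt_right (hc.intervalIntegrable _ _)
    (hc.stronglyMeasurableAtFilter _ _) hc.continuousAt).const_mul _

lemma deriv_angleHeight {q : ℝ} (hq : 0 < q) (a : ℝ) :
    deriv (angleHeight q a) = fun θ => (1 / q) * angleSpeed q (sinh a)⁻¹ θ :=
  funext fun θ => (hasDerivAt_angleHeight hq a θ).deriv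

lemma strictMono_angleHeight {q : ℝ} (hq : 0 < q) (a : ℝ) : StrictMono (angleHeight q a) := by
  apply strictMono_of_deriv_pos
  intro θ
  rw [deriv_angleHeight hq]
  have := angleSpeed_pos q (sinh a)⁻¹ θ
  positivity

@[simp] lemma angleHeight_zero (q a : ℝ) : angleHeight q a 0 = 0 := by simp [angleHeight]

lemma angleHeight_neg (q a θ : ℝ) : angleHeight q a (-θ) = -angleHeight q a θ := by
  have h : ∫ φ in (0 : ℝ)..(-θ), angleSpeed q (sinh a)⁻¹ φ
      = -∫ φ in (0 : ℝ)..θ, angleSpeed q (sinh a)⁻¹ φ := by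
    have := intervalIntegral.integral_comp_neg (a := 0) (b := θ)
      (fun φ => angleSpeed q (sinh a)⁻¹ φ)
    rw [neg_zero, intervalIntegral.integral_symm 0 (-θ)] at this
    rw [← neg_eq_iff_eq_neg, ← this]
    exact intervalIntegral.integral_congr fun φ _ => by simp [angleSpeed]
  rw [angleHeight, h, angleHeight]; ring

lemma continuous_angleHeight {q : ℝ} (hq : 0 < q) (a : ℝ) : Continuous (angleHeight q a) :=
  continuous_iff_continuousAt.2 fun θ => (hasDerivAt_angleHeight hq a θ).continuousAt

lemma mul_le_angleHeight {q θ : ℝ} (hq : 0 < q) (a : ℝ) (hθ : 0 ≤ θ) :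
    (1 / q) * (θ * (1 / √(1 + (sinh a)⁻¹ ^ 2))) ≤ angleHeight q a θ := by
  have hc := continuous_angleSpeed_right hq (sinh a)⁻¹
  unfold angleHeight
  gcongr
  have := intervalIntegral.integral_mono_on (μ := volume) hθ
    (intervalIntegrable_const (c := 1 / √(1 + (sinh a)⁻¹ ^ 2)))
    (hc.intervalIntegrable 0 θ) fun φ _ => angleSpeed_ge hq (sinh a)⁻¹ φ
  simpa using this

lemma surjective_angleHeight {q : ℝ} (hq : 0 < q) (a : ℝ) :
    Function.Surjective (angleHeight q a) := by
  have hk : 0 < (1 / q) * (1 / √(1 + (sinh a)⁻¹ ^ 2)) := by positivity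
  have htop : Tendsto (angleHeight q a) atTop atTop := by
    refine tendsto_atTop_mono' atTop ?_ (tendsto_id.atTop_mul_const hk)
    filter_upwards [eventually_ge_atTop (0 : ℝ)] with θ hθ
    have := mul_le_angleHeight hq a hθ
    simp only [id]; linarith
  have hbot : Tendsto (angleHeight q a) atBot atBot := by
    have h := tendsto_neg_atTop_atBot.comp (htop.comp tendsto_neg_atBot_atTop)
    refine h.congr fun θ => ?_
    simp [angleHeight_neg]
  exact (continuous_angleHeight hq a).surjective htop hbot

/-- Angle and height as coordinates on the profile curve. -/
noncomputable def angleHeightHomeo {q : ℝ} (hq : 0 < q) (a : ℝ) : ℝ ≃ₜ ℝ :=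
  (StrictMono.orderIsoOfSurjective _ (strictMono_angleHeight hq a)
    (surjective_angleHeight hq a)).toHomeomorph

@[simp] lemma angleHeightHomeo_apply {q : ℝ} (hq : 0 < q) (a θ : ℝ) :
    angleHeightHomeo hq a θ = angleHeight q a θ := rfl

/-- Heights up to which profile curves extend: half the length of the maximal interval. -/
noncomputable def maxHeight (q a : ℝ) : ℝ := angleHeight q a (π / 2)

/-- The speed is smallest at θ = 0, where it equals tanh a. For wide necks the bound tends to
π/(2q), the value of `heightBound` when q ≥ 1. -/
lemma le_maxHeight {q a : ℝ} (hq : 0 < q) (ha : 0 < a) :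
    π / (2 * q) * (sinh a / cosh a) ≤ maxHeight q a := by
  have h := mul_le_angleHeight hq a (θ := π / 2) (by positivity)
  have hs := sinh_pos_iff.2 ha
  have hc := cosh_pos a
  have h2 : 1 + (sinh a)⁻¹ ^ 2 = (cosh a / sinh a) ^ 2 := by
    have := cosh_sq a
    field_simp
    linarith
  rw [h2, Real.sqrt_sq (by positivity)] at h
  refine le_trans (le_of_eq ?_) h
  field_simp

/-- The speed is dominated by 1 and tends to 0 at almost every angle as 1 / sinh a grows. Thin necks
therefore never reach a given positive height. -/
lemma tendsto_maxHeight_zero {q : ℝ} (hq : 0 < q) :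
    Tendsto (maxHeight q) (𝓝[>] 0) (𝓝 0) := by
  have h : Tendsto (fun a : ℝ => ∫ φ in (0 : ℝ)..(π / 2), angleSpeed q (sinh a)⁻¹ φ) (𝓝[>] 0)
      (𝓝 (∫ φ in (0 : ℝ)..(π / 2), (0 : ℝ))) := by
    refine intervalIntegral.tendsto_integral_filter_of_dominated_convergence (fun _ => (1 : ℝ))
      (Eventually.of_forall fun a =>
        (continuous_angleSpeed_right hq _).aestronglyMeasurable)
      (Eventually.of_forall fun a => Eventually.of_forall fun φ _ => ?_)
      intervalIntegrable_const ?_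
    · rw [Real.norm_of_nonneg (angleSpeed_pos _ _ _).le]
      exact angleSpeed_le_one _ _ _
    -- At π/2 the cosine vanishes and the speed stays equal to 1; this is a null set.
    · have hne : ∀ᵐ φ : ℝ ∂volume, φ ≠ π / 2 := by
        simp [ae_iff]
      filter_upwards [hne] with φ hφ hmem
      rw [uIoc_of_le (by positivity)] at hmem
      have hcos : 0 < cos φ := cos_pos_of_mem_Ioo
        ⟨by linarith [hmem.1, pi_pos], lt_of_le_of_ne hmem.2 hφ⟩
      have hk : 0 < |cos φ| ^ (2 / q) := rpow_pos_of_pos (abs_pos.2 hcos.ne') _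
      have h1 : Tendsto (fun a : ℝ => (sinh a)⁻¹) (𝓝[>] 0) atTop := by
        refine tendsto_inv_nhdsGT_zero.comp ?_
        refine tendsto_nhdsWithin_iff.2 ⟨?_, ?_⟩
        · have := (continuous_sinh.tendsto 0).mono_left (nhdsWithin_le_nhds (s := Ioi 0))
          simpa using this
        · filter_upwards [self_mem_nhdsWithin] with a ha using sinh_pos_iff.2 ha
      have h2 : Tendsto (fun a : ℝ => √(1 + (sinh a)⁻¹ ^ 2 * |cos φ| ^ (2 / q))) (𝓝[>] 0)
          atTop := by
        refine tendsto_sqrt_atTop.comp (tendsto_atTop_add_const_left _ _ ?_)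
        exact ((tendsto_pow_atTop two_ne_zero).comp h1).atTop_mul_const hk
      refine h2.inv_tendsto_atTop.congr fun a => ?_
      simp [angleSpeed]
  have := h.const_mul (1 / q)
  rw [intervalIntegral.integral_zero, mul_zero] at this
  exact this

lemma continuousOn_angleHeight {q : ℝ} (hq : 0 < q) :
    ContinuousOn (Function.uncurry (angleHeight q)) (Ioi 0 ×ˢ univ) := by
  have h : Continuous fun p : ℝ × ℝ => ∫ φ in (0 : ℝ)..p.2, angleSpeed q p.1 φ := by
    refine intervalIntegral.continuous_parametric_intervalIntegral_of_continuous
      (f := fun p : ℝ × ℝ => angleSpeed q p.1) ?_ continuous_snd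
    exact (continuous_angleSpeed hq).comp
      (by fun_prop : Continuous fun x : (ℝ × ℝ) × ℝ => (x.1.1, x.2))
  have h2 : ContinuousOn (fun p : ℝ × ℝ => ((sinh p.1)⁻¹, p.2)) (Ioi 0 ×ˢ univ) := by
    refine ContinuousOn.prodMk (ContinuousOn.inv₀ (by fun_prop) ?_) (by fun_prop)
    rintro p ⟨hp, -⟩
    exact (sinh_pos_iff.2 hp).ne'
  exact continuousOn_const.mul (h.comp_continuousOn h2)

/-! ### Height as a function of the distance to the axis -/

lemma continuousOn_reach {q : ℝ} (hq : 0 < q) :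
    ContinuousOn (fun p : ℝ × ℝ => reach q p.1 p.2) (Ioi 0 ×ˢ Ioi 0) := by
  have h1 : ContinuousOn (fun p : ℝ × ℝ => neckAngle q p.1 p.2) (Ioi 0 ×ˢ Ioi 0) := by
    refine continuous_arccos.comp_continuousOn (ContinuousOn.rpow_const ?_ fun p _ =>
      Or.inr hq.le)
    refine ContinuousOn.div (by fun_prop) (by fun_prop) ?_
    rintro p ⟨-, hp⟩
    exact (sinh_pos_iff.2 hp).ne'
  exact (continuousOn_angleHeight hq).comp (continuousOn_fst.prodMk h1)
    fun p hp => ⟨hp.1, mem_univ _⟩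

lemma continuousOn_reach_right {q a : ℝ} (hq : 0 < q) (ha : 0 < a) :
    ContinuousOn (reach q a) (Ioi 0) :=
  (continuousOn_reach hq).comp (f := fun y : ℝ => (a, y)) (by fun_prop) fun _ hy => ⟨ha, hy⟩

lemma continuousOn_reach_left {q y : ℝ} (hq : 0 < q) (hy : 0 < y) :
    ContinuousOn (fun a => reach q a y) (Ioi 0) :=
  (continuousOn_reach hq).comp (f := fun a : ℝ => (a, y)) (by fun_prop) fun _ ha => ⟨ha, hy⟩

lemma neck_ratio_pos {q a y : ℝ} (ha : 0 < a) (hy : 0 < y) : 0 < (sinh a / sinh y) ^ q :=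
  rpow_pos_of_pos (div_pos (sinh_pos_iff.2 ha) (sinh_pos_iff.2 hy)) _

lemma neck_ratio_lt_one {q a y : ℝ} (hq : 0 < q) (ha : 0 < a) (hy : a < y) :
    (sinh a / sinh y) ^ q < 1 := by
  have hsa := sinh_pos_iff.2 ha
  have hsy := sinh_pos_iff.2 (ha.trans hy)
  refine rpow_lt_one (by positivity) ?_ hq
  rw [div_lt_one hsy]
  exact sinh_lt_sinh.2 hy

/-- `arccos` is constantly 0 on [1, ∞). This extension by zero stays continuous, so compactness and
intermediate values can be used without the constraint a ≤ y. -/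
lemma reach_eq_zero {q a y : ℝ} (hq : 0 < q) (hy : 0 < y) (h : y ≤ a) : reach q a y = 0 := by
  have h1 : 1 ≤ (sinh a / sinh y) ^ q := by
    refine one_le_rpow ?_ hq.le
    rw [one_le_div (sinh_pos_iff.2 hy)]
    exact sinh_le_sinh.2 h
  rw [reach, neckAngle, arccos_eq_zero.2 h1, angleHeight_zero]

lemma reach_lt_maxHeight {q a y : ℝ} (hq : 0 < q) (ha : 0 < a) (hy : 0 < y) :
    reach q a y < maxHeight q a :=
  strictMono_angleHeight hq a (arccos_lt_pi_div_two.2 (neck_ratio_pos ha hy))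

lemma hasDerivAt_neck_ratio {q a y : ℝ} (ha : 0 < a) (hy : 0 < y) :
    HasDerivAt (fun y => (sinh a / sinh y) ^ q)
      (-(q * (sinh a / sinh y) ^ q * (cosh y / sinh y))) y := by
  have hsa := sinh_pos_iff.2 ha
  have hsy := sinh_pos_iff.2 hy
  have h1 : HasDerivAt (fun y => sinh a / sinh y) (-(sinh a / sinh y * (cosh y / sinh y))) y := by
    have := (hasDerivAt_const y (sinh a)).div (hasDerivAt_sinh y) hsy.ne'
    refine this.congr_deriv ?_
    field_simp
    ring
  have h2 := h1.rpow_const (p := q) (Or.inl (by positivity))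
  refine h2.congr_deriv ?_
  rw [rpow_sub_one (by positivity)]
  field_simp

/-- With x the neck ratio, the chain rule multiplies (1/q) tanh y, -1/√(1 - x²) and -q x coth y; the
factors q and tanh y cancel. -/
lemma hasDerivAt_reach {q a y : ℝ} (hq : 0 < q) (ha : 0 < a) (hy : a < y) :
    HasDerivAt (reach q a)
      ((sinh a / sinh y) ^ q / √(1 - ((sinh a / sinh y) ^ q) ^ 2)) y := by
  have hy0 := ha.trans hy
  have hx0 := neck_ratio_pos (q := q) ha hy0
  have hx1 := neck_ratio_lt_one hq ha hy
  have hs : angleSpeed q (sinh a)⁻¹ (neckAngle q a y) = sinh y / cosh y := by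
    refine angleSpeed_eq hq ha hy0 ?_
    rw [neckAngle, cos_arccos (by linarith) hx1.le, abs_of_pos hx0]
  have h1 := (hasDerivAt_arccos (x := (sinh a / sinh y) ^ q) (by linarith) hx1.ne).comp y
    (hasDerivAt_neck_ratio (q := q) ha hy0)
  have h2 := (hasDerivAt_angleHeight hq a (neckAngle q a y)).comp y h1
  rw [hs] at h2
  have h3 : 0 < √(1 - ((sinh a / sinh y) ^ q) ^ 2) := Real.sqrt_pos.2 (by nlinarith)
  have hsy := sinh_pos_iff.2 hy0
  have hcy := cosh_pos y
  refine h2.congr_deriv ?_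
  field_simp

lemma strictMonoOn_reach {q a : ℝ} (hq : 0 < q) (ha : 0 < a) :
    StrictMonoOn (reach q a) (Ici a) := by
  refine strictMonoOn_of_deriv_pos (convex_Ici a)
    ((continuousOn_reach_right hq ha).mono fun y hy => ha.trans_le hy) ?_
  intro y hy
  rw [interior_Ici] at hy
  rw [(hasDerivAt_reach hq ha hy).deriv]
  have hx0 := neck_ratio_pos (q := q) ha (ha.trans hy)
  have hx1 := neck_ratio_lt_one hq ha hy
  have h3 : 0 < √(1 - ((sinh a / sinh y) ^ q) ^ 2) := Real.sqrt_pos.2 (by nlinarith)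
  positivity

lemma heightAt_eq_reach {q a ρ : ℝ} (hq : 0 < q) (ha : 0 < a) (hρ : a ≤ ρ) :
    heightAt q a ρ = reach q a ρ := by
  have hsa := sinh_pos_iff.2 ha
  have hcont : ContinuousOn (reach q a) (Icc a ρ) :=
    (continuousOn_reach_right hq ha).mono fun y hy => ha.trans_le hy.1
  set g : ℝ → ℝ := fun u => (sinh a / sinh u) ^ q / √(1 - ((sinh a / sinh u) ^ q) ^ 2) with hg
  have hder : ∀ u ∈ Ioo a ρ, HasDerivAt (reach q a) (g u) u :=
    fun u hu => hasDerivAt_reach hq ha hu.1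
  -- The integrand is singular at u = a; it is integrable as the nonnegative derivative of a
  -- function continuous up to the endpoint.
  have hint : IntervalIntegrable g volume a ρ := by
    refine intervalIntegral.intervalIntegrable_deriv_of_nonneg (g := reach q a) ?_ ?_ ?_
    · rwa [uIcc_of_le hρ]
    · rwa [min_eq_left hρ, max_eq_right hρ]
    · rw [min_eq_left hρ, max_eq_right hρ]
      intro u hu
      exact div_nonneg (neck_ratio_pos ha (ha.trans hu.1)).le (Real.sqrt_nonneg _)
  have hFTC := intervalIntegral.integral_eq_sub_of_hasDerivAt_of_le hρ hcont hder hint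
  rw [reach_eq_zero hq ha le_rfl, sub_zero] at hFTC
  rw [heightAt, ← intervalIntegral.integral_const_mul, ← hFTC]
  refine intervalIntegral.integral_congr fun u hu => ?_
  rw [uIcc_of_le hρ] at hu
  have hsu := sinh_pos_iff.2 (ha.trans_le hu.1)
  have hA : 0 < sinh a ^ q := rpow_pos_of_pos hsa q
  have hB : 0 < sinh u ^ q := rpow_pos_of_pos hsu q
  have e1 : sinh u ^ (2 * q) = (sinh u ^ q) ^ 2 := by
    rw [mul_comm, rpow_mul hsu.le]; norm_num
  have e2 : sinh a ^ (2 * q) = (sinh a ^ q) ^ 2 := by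
    rw [mul_comm, rpow_mul hsa.le]; norm_num
  have e3 : 1 - (sinh a ^ q / sinh u ^ q) ^ 2
      = ((sinh u ^ q) ^ 2 - (sinh a ^ q) ^ 2) / (sinh u ^ q) ^ 2 := by
    field_simp
  simp only [hg]
  rw [e1, e2, div_rpow hsa.le hsu.le, e3, Real.sqrt_div' _ (by positivity), Real.sqrt_sq hB.le]
  rw [div_div_div_eq, mul_comm (sinh u ^ q), mul_div_mul_right _ _ hB.ne', mul_one_div]

/-! ### The first integral of the profile equation -/

/-- The first integral of `f'' = q coth(f) (1 + f'²)`, at `f = y`, `f' = p`. -/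
noncomputable def energy (q y p : ℝ) : ℝ := log (sinh y) - log (1 + p ^ 2) / (2 * q)

/-- The second derivative s is left free: the bracket vanishes on solutions, and for positive slope
it is negative as soon as s exceeds q coth(f)(1 + p²), which is how the convexity argument uses it.
-/
lemma hasDerivAt_energy {q : ℝ} (hq : 0 < q) {f p : ℝ → ℝ} {t s : ℝ} (hf : 0 < f t)
    (h : HasDerivAt f (p t) t) (hp : HasDerivAt p s t) :
    HasDerivAt (fun t => energy q (f t) (p t))
      (p t * (cosh (f t) / sinh (f t) - s / (q * (1 + p t ^ 2)))) t := by
  have hs := sinh_pos_iff.2 hf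
  have h1 : HasDerivAt (fun t => log (sinh (f t))) (cosh (f t) * p t / sinh (f t)) t :=
    h.sinh.log hs.ne'
  have h0 : 0 < 1 + p t ^ 2 := by positivity
  have h2 : HasDerivAt (fun t => 1 + p t ^ 2) (2 * p t * s) t := by
    refine ((hp.pow 2).const_add 1).congr_deriv ?_
    norm_num
  refine (h1.sub ((h2.log h0.ne').div_const (2 * q))).congr_deriv ?_
  field_simp

/-- Comparing the energy with log sinh a amounts to comparing the neck ratio with the cosine of the
angle: equality on solutions, a strict inequality for half-sums of solutions. -/
lemma log_neck_ratio_sub {q a y : ℝ} (hq : 0 < q) (ha : 0 < a) (hy : 0 < y) (p : ℝ) :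
    log ((sinh a / sinh y) ^ q) - log (cos (arctan p))
      = q * (log (sinh a) - energy q y p) := by
  have hsa := sinh_pos_iff.2 ha
  have hsy := sinh_pos_iff.2 hy
  rw [log_rpow (by positivity), log_div hsa.ne' hsy.ne', cos_arctan, one_div, log_inv,
    log_sqrt (by positivity), energy]
  field_simp
  ring

lemma neck_ratio_eq_cos {q a y p : ℝ} (hq : 0 < q) (ha : 0 < a) (hy : 0 < y)
    (h : energy q y p = log (sinh a)) : (sinh a / sinh y) ^ q = cos (arctan p) := by
  have := log_neck_ratio_sub hq ha hy p
  rw [h, sub_self, mul_zero, sub_eq_zero] at this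
  exact log_injOn_pos (neck_ratio_pos ha hy) (cos_arctan_pos p) this

/-! ### Uniqueness of solutions -/

lemma IsProfileSolution.neck_pos {q a : ℝ} {J : Set ℝ} {f : ℝ → ℝ}
    (h : IsProfileSolution q a J f) : 0 < a := h.init ▸ h.pos 0 h.zero_mem

lemma IsProfileSolution.neck_ratio_eq {q a : ℝ} {J : Set ℝ} {f : ℝ → ℝ} (hq : 0 < q)
    (h : IsProfileSolution q a J f) {t : ℝ} (ht : t ∈ J) :
    (sinh a / sinh (f t)) ^ q = cos (arctan (deriv f t)) := by
  refine neck_ratio_eq_cos hq h.neck_pos (h.pos t ht) ?_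
  have hder : ∀ s ∈ J, HasDerivAt (fun s => energy q (f s) (deriv f s)) 0 s := by
    intro s hs
    refine (hasDerivAt_energy hq (h.pos s hs) (h.differentiable s hs).hasDerivAt
      (h.ode s hs)).congr_deriv ?_
    have : 0 < 1 + deriv f s ^ 2 := by positivity
    field_simp
    ring
  have hc := h.isOpen.is_const_of_deriv_eq_zero h.ordConnected.isPreconnected
    (fun s hs => (hder s hs).differentiableAt.differentiableWithinAt)
    (fun s hs => (hder s hs).deriv) ht h.zero_mem
  rw [hc, h.init, h.init_deriv]
  simp [energy]

/-- The angle moves at rate f''/(1 + f'²) = q coth f and the height at rate (1/q) tanh f per unit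
angle, so the product is 1. The angle at t is thereby determined by a and t. -/
lemma IsProfileSolution.angleHeight_eq {q a : ℝ} {J : Set ℝ} {f : ℝ → ℝ} (hq : 0 < q)
    (h : IsProfileSolution q a J f) {t : ℝ} (ht : t ∈ J) :
    angleHeight q a (arctan (deriv f t)) = t := by
  have hder : ∀ s ∈ J, HasDerivAt (fun s => angleHeight q a (arctan (deriv f s)) - s) 0 s := by
    intro s hs
    have h1 := (hasDerivAt_angleHeight hq a (arctan (deriv f s))).comp s (h.ode s hs).arctan
    have hsp : angleSpeed q (sinh a)⁻¹ (arctan (deriv f s)) = sinh (f s) / cosh (f s) := by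
      refine angleSpeed_eq hq h.neck_pos (h.pos s hs) ?_
      rw [h.neck_ratio_eq hq hs, abs_of_pos (cos_arctan_pos _)]
    rw [hsp] at h1
    refine (h1.sub (hasDerivAt_id s)).congr_deriv ?_
    have h2 := sinh_pos_iff.2 (h.pos s hs)
    have h3 := cosh_pos (f s)
    have : 0 < 1 + deriv f s ^ 2 := by positivity
    field_simp
    ring
  have hc := h.isOpen.is_const_of_deriv_eq_zero h.ordConnected.isPreconnected
    (fun s hs => (hder s hs).differentiableAt.differentiableWithinAt)
    (fun s hs => (hder s hs).deriv) ht h.zero_mem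
  simp only [h.init_deriv, arctan_zero, angleHeight_zero, sub_zero] at hc
  linarith

/-- The distance from the axis of the profile curve of neck size `a` where its angle is `θ`. -/
noncomputable def distAt (q a θ : ℝ) : ℝ := arsinh (sinh a * cos θ ^ (-(1 / q)))

lemma sinh_distAt (q a θ : ℝ) : sinh (distAt q a θ) = sinh a * cos θ ^ (-(1 / q)) :=
  sinh_arsinh _

lemma distAt_pos {q a θ : ℝ} (ha : 0 < a) (hθ : 0 < cos θ) : 0 < distAt q a θ :=
  arsinh_pos_iff.2 (mul_pos (sinh_pos_iff.2 ha) (rpow_pos_of_pos hθ _))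

lemma neck_ratio_distAt {q a θ : ℝ} (hq : 0 < q) (ha : 0 < a) (hθ : 0 < cos θ) :
    (sinh a / sinh (distAt q a θ)) ^ q = cos θ := by
  have hsa := sinh_pos_iff.2 ha
  have hc : 0 < cos θ ^ (1 / q) := rpow_pos_of_pos hθ _
  rw [sinh_distAt, rpow_neg hθ.le]
  have : sinh a / (sinh a * (cos θ ^ (1 / q))⁻¹) = cos θ ^ (1 / q) := by field_simp
  rw [this, ← rpow_mul hθ.le, one_div_mul_cancel hq.ne', rpow_one]

lemma eq_distAt_of_neck_ratio {q a y θ : ℝ} (hq : 0 < q) (ha : 0 < a) (hy : 0 < y)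
    (hθ : 0 < cos θ) (h : (sinh a / sinh y) ^ q = cos θ) : y = distAt q a θ := by
  have h1 := neck_ratio_distAt hq ha hθ
  rw [← h] at h1
  have hsa := sinh_pos_iff.2 ha
  have hsy := sinh_pos_iff.2 hy
  have hsd := sinh_pos_iff.2 (distAt_pos (q := q) ha hθ)
  have h2 := rpow_left_injOn hq.ne' (show (0 : ℝ) ≤ _ by positivity)
    (show (0 : ℝ) ≤ _ by positivity) h1
  rw [← sinh_inj]
  field_simp at h2
  exact h2

lemma hasDerivAt_distAt {q a θ : ℝ} (ha : 0 < a) (hθ : 0 < cos θ) :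
    HasDerivAt (distAt q a)
      (sinh (distAt q a θ) / cosh (distAt q a θ) * (sin θ / cos θ) * (1 / q)) θ := by
  have h1 : HasDerivAt (fun θ => sinh a * cos θ ^ (-(1 / q)))
      (sinh a * (-sin θ * -(1 / q) * cos θ ^ (-(1 / q) - 1))) θ :=
    ((hasDerivAt_cos θ).rpow_const (Or.inl hθ.ne')).const_mul _
  refine ((hasDerivAt_arsinh _).comp θ h1).congr_deriv ?_
  rw [← cosh_arsinh, ← distAt, sinh_distAt, rpow_sub_one hθ.ne']
  have := cosh_pos (distAt q a θ)
  field_simp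

lemma contDiffAt_distAt {q a θ : ℝ} (hθ : 0 < cos θ) : ContDiffAt ℝ ∞ (distAt q a) θ :=
  (contDiff_arsinh.contDiffAt).comp θ
    (contDiffAt_const.mul ((contDiff_cos.contDiffAt).rpow_const_of_ne hθ.ne'))

/-- Uniqueness: the right-hand side does not depend on the solution. -/
lemma IsProfileSolution.eq_distAt {q a : ℝ} {J : Set ℝ} {f : ℝ → ℝ} (hq : 0 < q)
    (h : IsProfileSolution q a J f) {t : ℝ} (ht : t ∈ J) :
    f t = distAt q a ((angleHeightHomeo hq a).symm t) := by
  have h1 : (angleHeightHomeo hq a).symm t = arctan (deriv f t) := by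
    rw [Homeomorph.symm_apply_eq, angleHeightHomeo_apply, h.angleHeight_eq hq ht]
  rw [h1]
  exact eq_distAt_of_neck_ratio hq h.neck_pos (h.pos t ht) (cos_arctan_pos _)
    (h.neck_ratio_eq hq ht)

/-- The angle is an arctangent, hence strictly between ±π/2, and the height is monotone in the
angle. -/
lemma IsProfileSolution.abs_lt {q a : ℝ} {J : Set ℝ} {f : ℝ → ℝ} (hq : 0 < q)
    (h : IsProfileSolution q a J f) {t : ℝ} (ht : t ∈ J) :
    t ∈ Ioo (-maxHeight q a) (maxHeight q a) := by
  rw [← h.angleHeight_eq hq ht, maxHeight, ← angleHeight_neg]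
  exact ⟨strictMono_angleHeight hq a (neg_pi_div_two_lt_arctan _),
    strictMono_angleHeight hq a (arctan_lt_pi_div_two _)⟩

/-! ### Existence of solutions -/

lemma cos_symm_pos {q a : ℝ} (hq : 0 < q) {t : ℝ}
    (ht : t ∈ Ioo (-maxHeight q a) (maxHeight q a)) :
    0 < cos ((angleHeightHomeo hq a).symm t) := by
  obtain ⟨θ, rfl⟩ := (angleHeightHomeo hq a).surjective t
  rw [Homeomorph.symm_apply_apply]
  rw [angleHeightHomeo_apply, maxHeight, ← angleHeight_neg] at ht
  exact cos_pos_of_mem_Ioo ⟨(strictMono_angleHeight hq a).lt_iff_lt.1 ht.1,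
    (strictMono_angleHeight hq a).lt_iff_lt.1 ht.2⟩

lemma hasDerivAt_angle {q a : ℝ} (hq : 0 < q) (ha : 0 < a) {t : ℝ}
    (ht : t ∈ Ioo (-maxHeight q a) (maxHeight q a)) :
    HasDerivAt (angleHeightHomeo hq a).symm
      (q * (cosh (distAt q a ((angleHeightHomeo hq a).symm t))
        / sinh (distAt q a ((angleHeightHomeo hq a).symm t)))) t := by
  set θ := (angleHeightHomeo hq a).symm t
  have hθ : 0 < cos θ := cos_symm_pos hq ht
  have hd := distAt_pos (q := q) ha hθ
  have hs := sinh_pos_iff.2 hd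
  have hc := cosh_pos (distAt q a θ)
  have h1 := hasDerivAt_angleHeight hq a θ
  rw [angleSpeed_eq hq ha hd (by rw [neck_ratio_distAt hq ha hθ, abs_of_pos hθ])] at h1
  refine (HasDerivAt.of_local_left_inverse
    (angleHeightHomeo hq a).symm.continuous.continuousAt h1 (by positivity)
    (Eventually.of_forall fun y => (angleHeightHomeo hq a).apply_symm_apply y)).congr_deriv ?_
  field_simp

/-- The solution of the Cauchy problem, in terms of the inverse of `angleHeight`. -/
noncomputable def solution {q : ℝ} (hq : 0 < q) (a t : ℝ) : ℝ :=
  distAt q a ((angleHeightHomeo hq a).symm t)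

lemma hasDerivAt_solution {q a : ℝ} (hq : 0 < q) (ha : 0 < a) {t : ℝ}
    (ht : t ∈ Ioo (-maxHeight q a) (maxHeight q a)) :
    HasDerivAt (solution hq a) (tan ((angleHeightHomeo hq a).symm t)) t := by
  have hθ := cos_symm_pos hq ht
  refine ((hasDerivAt_distAt (q := q) ha hθ).comp t (hasDerivAt_angle hq ha ht)).congr_deriv ?_
  have hs := sinh_pos_iff.2 (distAt_pos (q := q) ha hθ)
  have hc := cosh_pos (distAt q a ((angleHeightHomeo hq a).symm t))
  rw [tan_eq_sin_div_cos]
  field_simp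

lemma isProfileSolution_solution {q a : ℝ} (hq : 0 < q) (ha : 0 < a) :
    IsProfileSolution q a (Ioo (-maxHeight q a) (maxHeight q a)) (solution hq a) where
  isOpen := isOpen_Ioo
  ordConnected := ordConnected_Ioo
  zero_mem := by
    have : 0 < maxHeight q a := by
      have := strictMono_angleHeight hq a (show (0 : ℝ) < π / 2 by positivity)
      rwa [angleHeight_zero] at this
    exact ⟨by linarith, this⟩
  pos t ht := distAt_pos ha (cos_symm_pos hq ht)
  differentiable t ht := (hasDerivAt_solution hq ha ht).differentiableAt
  ode t ht := by
    have hθ := cos_symm_pos hq ht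
    have h1 := (hasDerivAt_tan hθ.ne').comp t (hasDerivAt_angle hq ha ht)
    have h2 : deriv (solution hq a) =ᶠ[𝓝 t] tan ∘ (angleHeightHomeo hq a).symm := by
      filter_upwards [isOpen_Ioo.mem_nhds ht] with s hs using (hasDerivAt_solution hq ha hs).deriv
    refine (h1.congr_of_eventuallyEq h2).congr_deriv ?_
    rw [(hasDerivAt_solution hq ha ht).deriv, ← inv_one_add_tan_sq hθ.ne', solution]
    have : 0 < 1 + tan ((angleHeightHomeo hq a).symm t) ^ 2 := by positivity
    field_simp
  init := by
    have : (angleHeightHomeo hq a).symm 0 = 0 := by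
      rw [Homeomorph.symm_apply_eq, angleHeightHomeo_apply, angleHeight_zero]
    rw [solution, this, distAt]
    simp
  init_deriv := by
    have h0 : (angleHeightHomeo hq a).symm 0 = 0 := by
      rw [Homeomorph.symm_apply_eq, angleHeightHomeo_apply, angleHeight_zero]
    have : 0 < maxHeight q a := by
      have := strictMono_angleHeight hq a (show (0 : ℝ) < π / 2 by positivity)
      rwa [angleHeight_zero] at this
    rw [(hasDerivAt_solution hq ha ⟨by linarith, this⟩).deriv, h0, tan_zero]

lemma contDiffOn_solution {q a : ℝ} (hq : 0 < q) (ha : 0 < a) :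
    ContDiffOn ℝ ∞ (solution hq a) (Ioo (-maxHeight q a) (maxHeight q a)) := by
  intro t ht
  have hθ := cos_symm_pos hq ht
  -- Where the cosine is positive the absolute value drops out and the real power is smooth; at its
  -- zeros smoothness may fail.
  have hU : IsOpen {θ : ℝ | 0 < cos θ} := isOpen_lt continuous_const continuous_cos
  have hsm : ContDiffAt ℝ ∞ (angleHeight q a) ((angleHeightHomeo hq a).symm t) := by
    refine ContDiffOn.contDiffAt (s := {θ : ℝ | 0 < cos θ}) ?_ (hU.mem_nhds hθ)
    refine (contDiffOn_infty_iff_deriv_of_isOpen hU).2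
      ⟨fun θ _ => (hasDerivAt_angleHeight hq a θ).differentiableAt.differentiableWithinAt, ?_⟩
    rw [deriv_angleHeight hq]
    have h1 : ContDiffOn ℝ ∞ (fun θ => cos θ ^ (2 / q)) {θ : ℝ | 0 < cos θ} :=
      fun θ hθ => ((contDiff_cos.contDiffAt).rpow_const_of_ne
        (ne_of_gt hθ)).contDiffWithinAt
    have h2 : ContDiffOn ℝ ∞ (fun θ => (1 / q) * (1 / √(1 + (sinh a)⁻¹ ^ 2 * cos θ ^ (2 / q))))
        {θ : ℝ | 0 < cos θ} := by
      refine contDiffOn_const.mul (contDiffOn_const.div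
        ((contDiffOn_const.add (contDiffOn_const.mul h1)).sqrt ?_) ?_)
      · intro θ hθ
        have : 0 < cos θ ^ (2 / q) := rpow_pos_of_pos hθ _
        positivity
      · intro θ hθ
        have : 0 < cos θ ^ (2 / q) := rpow_pos_of_pos hθ _
        positivity
    refine h2.congr fun θ hθ => ?_
    rw [angleSpeed, abs_of_pos hθ]
  have hθs : ContDiffAt ℝ ∞ (angleHeightHomeo hq a).symm t :=
    (angleHeightHomeo hq a).toOpenPartialHomeomorph.contDiffAt_symm_deriv
      (f₀' := (1 / q) * angleSpeed q (sinh a)⁻¹ ((angleHeightHomeo hq a).symm t))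
      (by have := angleSpeed_pos q (sinh a)⁻¹ ((angleHeightHomeo hq a).symm t); positivity)
      (mem_univ _) (hasDerivAt_angleHeight hq a _) hsm
  exact ((contDiffAt_distAt hθ).comp t hθs).contDiffWithinAt

/-! ### The maximal solution -/

lemma profileDomain_eq {q a : ℝ} (hq : 0 < q) (ha : 0 < a) :
    profileDomain q a = Ioo (-maxHeight q a) (maxHeight q a) := by
  ext t
  constructor
  · rintro ⟨J, f, h, ht⟩
    exact h.abs_lt hq ht
  · intro ht
    exact ⟨_, _, isProfileSolution_solution hq ha, ht⟩

lemma profile_eq_solution {q a t : ℝ} (hq : 0 < q) (ht : t ∈ profileDomain q a) :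
    profile q a t = solution hq a t := by
  obtain ⟨J, f, h, htJ⟩ := ht
  have hex : ∃ f : ℝ → ℝ, ∃ J, IsProfileSolution q a J f ∧ t ∈ J := ⟨f, J, h, htJ⟩
  rw [profile, dif_pos hex]
  obtain ⟨J', h', ht'⟩ := hex.choose_spec
  exact h'.eq_distAt hq ht'

lemma IsProfileSolution.congr {q a : ℝ} {J : Set ℝ} {f g : ℝ → ℝ}
    (h : IsProfileSolution q a J f) (hg : EqOn g f J) : IsProfileSolution q a J g := by
  have hev : ∀ t ∈ J, g =ᶠ[𝓝 t] f := fun t ht => hg.eventuallyEq_of_mem (h.isOpen.mem_nhds ht)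
  have hd : EqOn (deriv g) (deriv f) J := fun t ht => (hev t ht).deriv_eq
  refine ⟨h.isOpen, h.ordConnected, h.zero_mem, fun t ht => hg ht ▸ h.pos t ht,
    fun t ht => (h.differentiable t ht).congr_of_eventuallyEq (hev t ht), fun t ht => ?_,
    (hg h.zero_mem).trans h.init, (hd h.zero_mem).trans h.init_deriv⟩
  rw [hg ht, hd ht]
  exact (h.ode t ht).congr_of_eventuallyEq (hd.eventuallyEq_of_mem (h.isOpen.mem_nhds ht))

lemma isProfileSolution_profile {q a : ℝ} (hq : 0 < q) (ha : 0 < a) :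
    IsProfileSolution q a (profileDomain q a) (profile q a) := by
  have h := isProfileSolution_solution hq ha
  rw [← profileDomain_eq hq ha] at h
  exact h.congr fun t ht => profile_eq_solution hq ht

lemma contDiffOn_profile {q a : ℝ} (hq : 0 < q) (ha : 0 < a) :
    ContDiffOn ℝ ∞ (profile q a) (profileDomain q a) := by
  have h := contDiffOn_solution hq ha
  rw [← profileDomain_eq hq ha] at h
  exact h.congr fun t ht => profile_eq_solution hq ht

lemma IsProfileSolution.le {q a t : ℝ} {J : Set ℝ} {f : ℝ → ℝ} (hq : 0 < q)
    (h : IsProfileSolution q a J f) (ht : t ∈ J) : a ≤ f t := by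
  by_contra hlt
  push Not at hlt
  have hsf := sinh_pos_iff.2 (h.pos t ht)
  have h1 : 1 < (sinh a / sinh (f t)) ^ q := by
    refine one_lt_rpow ?_ hq
    rw [one_lt_div hsf]
    exact sinh_lt_sinh.2 hlt
  rw [h.neck_ratio_eq hq ht] at h1
  linarith [cos_le_one (arctan (deriv f t))]

/-- `arccos` recovers only |θ|, and the height is odd in θ; hence |t|. The evenness of the profile
is contained in this identity. -/
lemma IsProfileSolution.reach_eq {q a t : ℝ} {J : Set ℝ} {f : ℝ → ℝ} (hq : 0 < q)
    (h : IsProfileSolution q a J f) (ht : t ∈ J) : reach q a (f t) = |t| := by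
  have hθ := h.angleHeight_eq hq ht
  rw [reach, neckAngle, h.neck_ratio_eq hq ht, ← cos_abs, arccos_cos (abs_nonneg _)
    (by rw [abs_le]; constructor <;>
      linarith [neg_pi_div_two_lt_arctan (deriv f t), arctan_lt_pi_div_two (deriv f t), pi_pos])]
  rcases le_total 0 (arctan (deriv f t)) with h0 | h0
  · have : 0 ≤ t := by
      rw [← hθ, ← angleHeight_zero q a]
      exact (strictMono_angleHeight hq a).monotone h0
    rw [abs_of_nonneg h0, abs_of_nonneg this, hθ]
  · have : t ≤ 0 := by
      rw [← hθ, ← angleHeight_zero q a]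
      exact (strictMono_angleHeight hq a).monotone h0
    rw [abs_of_nonpos h0, abs_of_nonpos this, angleHeight_neg, hθ]

lemma le_profile {q a t : ℝ} (hq : 0 < q) (ha : 0 < a) (ht : t ∈ profileDomain q a) :
    a ≤ profile q a t := (isProfileSolution_profile hq ha).le hq ht

lemma reach_profile {q a t : ℝ} (hq : 0 < q) (ha : 0 < a) (ht : t ∈ profileDomain q a) :
    reach q a (profile q a t) = |t| := (isProfileSolution_profile hq ha).reach_eq hq ht

lemma mem_profileDomain_iff {q a t : ℝ} (hq : 0 < q) (ha : 0 < a) :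
    t ∈ profileDomain q a ↔ |t| < maxHeight q a := by
  rw [profileDomain_eq hq ha, _root_.abs_lt, mem_Ioo]

lemma profile_eq_of_reach {q a y t : ℝ} (hq : 0 < q) (ha : 0 < a) (hy : a ≤ y)
    (h : reach q a y = |t|) : t ∈ profileDomain q a ∧ profile q a t = y := by
  have ht : t ∈ profileDomain q a := by
    rw [mem_profileDomain_iff hq ha, ← h]
    exact reach_lt_maxHeight hq ha (ha.trans_le hy)
  refine ⟨ht, (strictMonoOn_reach hq ha).injOn (le_profile hq ha ht) hy ?_⟩
  rw [h, reach_profile hq ha ht]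

/-- The condition a < y comes for free, because `reach` vanishes when y ≤ a. -/
lemma profile_lt_of_lt_reach {q a y t : ℝ} (hq : 0 < q) (ha : 0 < a) (ht : 0 ≤ t) (hy : 0 < y)
    (h : t < reach q a y) : t ∈ profileDomain q a ∧ profile q a t < y := by
  have htd : t ∈ profileDomain q a := by
    rw [mem_profileDomain_iff hq ha, abs_of_nonneg ht]
    exact h.trans (reach_lt_maxHeight hq ha hy)
  have hay : a < y := by
    by_contra hle
    rw [reach_eq_zero hq hy (not_lt.1 hle)] at h
    linarith
  refine ⟨htd, ((strictMonoOn_reach hq ha).lt_iff_lt (le_profile hq ha htd) hay.le).1 ?_⟩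
  rwa [reach_profile hq ha htd, abs_of_nonneg ht]

/-! ### Convexity of the height in the neck size -/

/-- Concavity of tanh, in reciprocal form. Over the common denominator sinh(x + y) the numerators
are cosh(x + y) + 1 and cosh(x + y) + cosh(x - y). -/
lemma coth_midpoint_le {x y : ℝ} (hx : 0 < x) (hy : 0 < y) :
    cosh ((x + y) / 2) / sinh ((x + y) / 2)
      ≤ 2 / (sinh x / cosh x + sinh y / cosh y)
    ∧ (x ≠ y → cosh ((x + y) / 2) / sinh ((x + y) / 2)
      < 2 / (sinh x / cosh x + sinh y / cosh y)) := by
  have hsx := sinh_pos_iff.2 hx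
  have hsy := sinh_pos_iff.2 hy
  have hcx := cosh_pos x
  have hcy := cosh_pos y
  have hm : 0 < (x + y) / 2 := by linarith
  have hsm := sinh_pos_iff.2 hm
  have hcm := cosh_pos ((x + y) / 2)
  have e1 : 2 / (sinh x / cosh x + sinh y / cosh y)
      = (cosh (x + y) + cosh (x - y)) / sinh (x + y) := by
    rw [cosh_add, cosh_sub, sinh_add]
    field_simp
    ring
  have e2 : cosh ((x + y) / 2) / sinh ((x + y) / 2) = (cosh (x + y) + 1) / sinh (x + y) := by
    have h2 : x + y = 2 * ((x + y) / 2) := by ring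
    have h3 : cosh (x + y) + 1 = 2 * cosh ((x + y) / 2) ^ 2 := by
      rw [h2, cosh_two_mul, ← h2]
      linarith [cosh_sq ((x + y) / 2)]
    have h4 : sinh (x + y) = 2 * sinh ((x + y) / 2) * cosh ((x + y) / 2) := by
      conv_lhs => rw [h2, sinh_two_mul]
    rw [h3, h4]
    field_simp
  have hs : 0 < sinh (x + y) := sinh_pos_iff.2 (by linarith)
  rw [e1, e2]
  constructor
  · gcongr
    exact one_le_cosh _
  · intro hne
    gcongr
    exact one_lt_cosh.2 (sub_ne_zero.2 hne)

/-- Midpoint convexity of (g, p) ↦ (1 + p²)/g on g > 0; the defect is a sum of two squares over a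
positive denominator. -/
lemma two_div_add_mul_le {g k p r : ℝ} (hg : 0 < g) (hk : 0 < k) :
    2 / (g + k) * (1 + ((p + r) / 2) ^ 2) ≤ (1 / g * (1 + p ^ 2) + 1 / k * (1 + r ^ 2)) / 2 := by
  rw [← sub_nonneg]
  have : (1 / g * (1 + p ^ 2) + 1 / k * (1 + r ^ 2)) / 2 - 2 / (g + k) * (1 + ((p + r) / 2) ^ 2)
      = ((g - k) ^ 2 + (p * k - r * g) ^ 2) / (2 * g * k * (g + k)) := by
    field_simp
    ring
  rw [this]
  positivity

lemma coth_mul_midpoint_le {x y p r : ℝ} (hx : 0 < x) (hy : 0 < y) :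
    cosh ((x + y) / 2) / sinh ((x + y) / 2) * (1 + ((p + r) / 2) ^ 2)
      ≤ (cosh x / sinh x * (1 + p ^ 2) + cosh y / sinh y * (1 + r ^ 2)) / 2
    ∧ (x ≠ y → cosh ((x + y) / 2) / sinh ((x + y) / 2) * (1 + ((p + r) / 2) ^ 2)
      < (cosh x / sinh x * (1 + p ^ 2) + cosh y / sinh y * (1 + r ^ 2)) / 2) := by
  have hsx := sinh_pos_iff.2 hx
  have hsy := sinh_pos_iff.2 hy
  have hcx := cosh_pos x
  have hcy := cosh_pos y
  have h := two_div_add_mul_le (p := p) (r := r) (div_pos hsx hcx) (div_pos hsy hcy)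
  rw [one_div_div, one_div_div] at h
  have hpos : 0 < 1 + ((p + r) / 2) ^ 2 := by positivity
  obtain ⟨h1, h2⟩ := coth_midpoint_le hx hy
  exact ⟨(mul_le_mul_of_nonneg_right h1 hpos.le).trans h,
    fun hne => (mul_lt_mul_of_pos_right (h2 hne) hpos).trans_le h⟩

lemma IsProfileSolution.deriv_pos {q a t : ℝ} {J : Set ℝ} {f : ℝ → ℝ} (hq : 0 < q)
    (h : IsProfileSolution q a J f) (ht : t ∈ J) (h0 : 0 < t) : 0 < deriv f t := by
  rw [← arctan_pos, ← (strictMono_angleHeight hq a).lt_iff_lt, angleHeight_zero,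
    h.angleHeight_eq hq ht]
  exact h0

/-- Strict midpoint convexity of a ↦ f(a, t₀), in a form that does not presuppose that the middle
catenoid reaches t₀: its curve would attain the average radius only at a height above t₀. -/
lemma lt_reach_midpoint {q a b t₀ : ℝ} (hq : 0 < q) (ha : 0 < a) (hab : a < b) (ht₀ : 0 < t₀)
    (hta : t₀ ∈ profileDomain q a) (htb : t₀ ∈ profileDomain q b) :
    t₀ < reach q ((a + b) / 2) ((profile q a t₀ + profile q b t₀) / 2) := by
  have hb := ha.trans hab
  have hf := isProfileSolution_profile hq ha
  have hg := isProfileSolution_profile hq hb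
  set f := profile q a
  set g := profile q b
  set c := (a + b) / 2 with hc
  have hc0 : 0 < c := by positivity
  have hJf : Icc 0 t₀ ⊆ profileDomain q a := hf.ordConnected.out hf.zero_mem hta
  have hJg : Icc 0 t₀ ⊆ profileDomain q b := hg.ordConnected.out hg.zero_mem htb
  set h : ℝ → ℝ := fun t => (f t + g t) / 2 with hh
  set h' : ℝ → ℝ := fun t => (deriv f t + deriv g t) / 2 with hh'
  have hhd : ∀ t ∈ Icc 0 t₀, HasDerivAt h (h' t) t := fun t ht =>
    (((hf.differentiable t (hJf ht)).hasDerivAt).add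
      ((hg.differentiable t (hJg ht)).hasDerivAt)).div_const 2
  have hh'd : ∀ t ∈ Icc 0 t₀, HasDerivAt h' _ t := fun t ht =>
    ((hf.ode t (hJf ht)).add (hg.ode t (hJg ht))).div_const 2
  have hpos : ∀ t ∈ Icc 0 t₀, 0 < h t := fun t ht => by
    have h1 := hf.pos t (hJf ht)
    have h2 := hg.pos t (hJg ht)
    simp only [hh]; positivity
  have hpos' : ∀ t ∈ Icc 0 t₀, 0 < t → 0 < h' t := fun t ht h0 => by
    have h1 := hf.deriv_pos hq (hJf ht) h0
    have h2 := hg.deriv_pos hq (hJg ht) h0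
    simp only [hh']; positivity
  set e : ℝ → ℝ := fun t => energy q (h t) (h' t) with he
  have hed := fun t ht => hasDerivAt_energy hq (hpos t ht) (hhd t ht) (hh'd t ht)
  have hecont : ContinuousOn e (Icc 0 t₀) :=
    fun t ht => (hed t ht).continuousAt.continuousWithinAt
  -- By convexity the half-sum satisfies h'' ≥ q coth(h)(1 + h'²), strictly where f ≠ g, and h' > 0.
  have key : ∀ t ∈ Icc 0 t₀, 0 < t → deriv e t ≤ 0 ∧ (f t ≠ g t → deriv e t < 0) := by
    intro t ht h0
    rw [(hed t ht).deriv]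
    obtain ⟨k1, k2⟩ := coth_mul_midpoint_le (p := deriv f t) (r := deriv g t)
      (hf.pos t (hJf ht)) (hg.pos t (hJg ht))
    have hp := hpos' t ht h0
    have hq1 : 0 < q * (1 + h' t ^ 2) := by positivity
    constructor
    · refine mul_nonpos_of_nonneg_of_nonpos hp.le (sub_nonpos.2 ?_)
      rw [le_div_iff₀ hq1]
      have := mul_le_mul_of_nonneg_left k1 hq.le
      simp only [hh, hh']
      linarith
    · intro hne
      refine mul_neg_of_pos_of_neg hp (sub_neg.2 ?_)
      rw [lt_div_iff₀ hq1]
      have := mul_lt_mul_of_pos_left (k2 hne) hq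
      simp only [hh, hh']
      linarith
  have hanti : AntitoneOn e (Icc 0 t₀) := by
    refine antitoneOn_of_deriv_nonpos (convex_Icc 0 t₀) hecont ?_ ?_
    · exact fun t ht => (hed t (interior_subset ht)).differentiableAt.differentiableWithinAt
    · intro t ht
      rw [interior_Icc] at ht
      exact (key t (Ioo_subset_Icc_self ht) ht.1).1
  have he0 : e 0 = log (sinh c) := by
    simp [he, hh, hh', energy, hf.init, hg.init, hf.init_deriv, hg.init_deriv, hc]
  have helt : ∀ t ∈ Icc 0 t₀, 0 < t → e t < log (sinh c) := by
    intro t ht h0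
    -- Since f(0) = a < b = g(0), the energy drops strictly on a short initial interval, and
    -- afterwards it cannot rise.
    have hev : ∀ᶠ s in 𝓝 (0 : ℝ), f s < g s := by
      have c1 := (hf.differentiable 0 hf.zero_mem).continuousAt
      have c2 := (hg.differentiable 0 hg.zero_mem).continuousAt
      refine c1.eventually_lt c2 ?_
      rw [hf.init, hg.init]
      exact hab
    obtain ⟨δ, hδ, hball⟩ := Metric.eventually_nhds_iff.1 hev
    set ε := min (δ / 2) t with hε
    have hε0 : 0 < ε := by positivity
    have hεt : ε ≤ t := min_le_right _ _
    have hεδ : ε < δ := (min_le_left _ _).trans_lt (by linarith)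
    have hsub : Icc 0 ε ⊆ Icc 0 t₀ := Icc_subset_Icc_right (hεt.trans ht.2)
    have hst : StrictAntiOn e (Icc 0 ε) := by
      refine strictAntiOn_of_deriv_neg (convex_Icc 0 ε) (hecont.mono hsub) ?_
      intro s hs
      rw [interior_Icc] at hs
      refine (key s (hsub (Ioo_subset_Icc_self hs)) hs.1).2 (ne_of_lt (hball ?_))
      rw [dist_zero_right, norm_of_nonneg hs.1.le]
      exact hs.2.trans hεδ
    calc e t ≤ e ε := hanti (hsub ⟨hε0.le, le_rfl⟩) ht hεt
      _ < e 0 := hst ⟨le_rfl, hε0.le⟩ ⟨hε0.le, le_rfl⟩ hε0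
      _ = log (sinh c) := he0
  -- The derivative formula for `reach q c` is available only strictly beyond the neck.
  have hcle : ∀ t ∈ Icc 0 t₀, 0 < t → c < h t := by
    intro t ht h0
    have h1 := hf.le hq (hJf ht)
    have h2 := hg.le hq (hJg ht)
    have h3 : f t ≠ a := by
      intro heq
      have := hf.reach_eq hq (hJf ht)
      rw [heq, reach_eq_zero hq ha le_rfl, abs_of_pos h0] at this
      exact h0.ne this
    have h4 := lt_of_le_of_ne h1 h3.symm
    simp only [hc, hh]; linarith
  have h00 : h 0 = c := by simp only [hh, hc, hf.init, hg.init]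
  -- With x the neck ratio at h(t), the derivative is h' x/√(1 - x²) - 1. Energy below log sinh c
  -- means x√(1 + h'²) > 1, that is, h' x > √(1 - x²).
  have hmono : StrictMonoOn (fun t => reach q c (h t) - t) (Icc 0 t₀) := by
    refine strictMonoOn_of_deriv_pos (convex_Icc 0 t₀) ?_ ?_
    · refine ContinuousOn.sub ?_ continuousOn_id
      exact (continuousOn_reach_right hq hc0).comp
        (fun t ht => (hhd t ht).continuousAt.continuousWithinAt) fun t ht => hpos t ht
    · intro t ht
      rw [interior_Icc] at ht
      have htI := Ioo_subset_Icc_self ht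
      have hd : HasDerivAt (fun t => reach q c (h t) - t) _ t :=
        ((hasDerivAt_reach hq hc0 (hcle t htI ht.1)).comp t (hhd t htI)).sub (hasDerivAt_id t)
      rw [hd.deriv]
      have hp := hpos' t htI ht.1
      have hx0 := neck_ratio_pos (q := q) hc0 (hpos t htI)
      have hx1 := neck_ratio_lt_one hq hc0 (hcle t htI ht.1)
      have hlog := log_neck_ratio_sub hq hc0 (hpos t htI) (h' t)
      have hlt := mul_pos hq (sub_pos.2 (helt t htI ht.1))
      rw [← hlog, sub_pos, log_lt_log_iff (cos_arctan_pos _) hx0, cos_arctan] at hlt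
      set x := (sinh c / sinh (h t)) ^ q
      have hsq : 0 < √(1 - x ^ 2) := Real.sqrt_pos.2 (by nlinarith)
      have h1 : 1 < x ^ 2 * (1 + h' t ^ 2) := by
        have h2 : 0 < √(1 + h' t ^ 2) := by positivity
        rw [div_lt_iff₀ h2] at hlt
        have h3 := one_lt_pow₀ hlt two_ne_zero
        rwa [mul_pow, Real.sq_sqrt (by positivity)] at h3
      rw [sub_pos, div_mul_eq_mul_div, lt_div_iff₀ hsq, one_mul, Real.sqrt_lt' (by positivity)]
      nlinarith
  have := hmono (left_mem_Icc.2 ht₀.le) (right_mem_Icc.2 ht₀.le) ht₀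
  simp only [h00, reach_eq_zero hq hc0 le_rfl] at this
  linarith

/-! ### The neck size of least boundary radius -/

lemma reaching_iff {q t₀ a : ℝ} (hq : 0 < q) (ht₀ : 0 < t₀) :
    a ∈ reaching q t₀ ↔ 0 < a ∧ t₀ < maxHeight q a := by
  constructor
  · rintro ⟨ha, h⟩
    rw [mem_profileDomain_iff hq ha, abs_of_pos ht₀] at h
    exact ⟨ha, h⟩
  · rintro ⟨ha, h⟩
    refine ⟨ha, ?_⟩
    rwa [mem_profileDomain_iff hq ha, abs_of_pos ht₀]

/-- The role of T: for q ≥ 1 wide necks have maximal height at least close to π/(2q); for q < 1 some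
λ(a, M) exceeds t₀, and it is less than the maximal height. -/
lemma reaching_nonempty {q t₀ : ℝ} (hq : 0 < q) (ht₀ : 0 < t₀) (h : t₀ < heightBound q) :
    (reaching q t₀).Nonempty := by
  unfold heightBound at h
  split_ifs at h with h1
  · have ht : Tendsto (fun a : ℝ => π / (2 * q) * (sinh a / cosh a)) atTop
        (𝓝 (π / (2 * q) * 1)) := by
      refine Tendsto.const_mul _ ?_
      -- Squeeze: 1 - e^(-a) ≤ tanh a ≤ 1.
      have hexp : Tendsto (fun a : ℝ => 1 - rexp (-a)) atTop (𝓝 (1 - 0)) :=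
        (tendsto_exp_comp_nhds_zero.2 tendsto_neg_atTop_atBot).const_sub 1
      rw [sub_zero] at hexp
      refine tendsto_of_tendsto_of_tendsto_of_le_of_le hexp tendsto_const_nhds (fun a => ?_)
        fun a => (div_le_one (cosh_pos a)).2 (sinh_lt_cosh a).le
      simp only
      rw [le_div_iff₀ (cosh_pos a), ← cosh_sub_sinh]
      nlinarith [one_le_cosh a, sinh_lt_cosh a]
    rw [mul_one] at ht
    obtain ⟨a, ha, ha0⟩ := ((ht.eventually_const_lt h).and (eventually_gt_atTop 0)).exists
    exact ⟨a, (reaching_iff hq ht₀).2 ⟨ha0, ha.trans_le (le_maxHeight hq ha0)⟩⟩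
  -- The supremum of the empty set is 0 by convention, which t₀ > 0 excludes.
  · have hne : (Ioo 0 (critRadius q)).Nonempty := by
      by_contra hemp
      rw [not_nonempty_iff_eq_empty] at hemp
      rw [hemp, image_empty, Real.sSup_empty] at h
      linarith
    obtain ⟨_, ⟨a, ha, rfl⟩, hlt⟩ := exists_lt_of_lt_csSup (hne.image _) h
    refine ⟨a, (reaching_iff hq ht₀).2 ⟨ha.1, hlt.trans ?_⟩⟩
    simp only
    rw [heightAt_eq_reach hq ha.1 ha.2.le]
    exact reach_lt_maxHeight hq ha.1 (ha.1.trans ha.2)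

/-- Instead of a ↦ f(a, t₀), the coordinate y is minimised over pairs (a, y) with `reach q a y` ≥
t₀, a compact set once a and y are confined to a box. Thin necks are excluded by their small maximal
height, wide ones by a ≤ f(a, t₀). -/
lemma exists_isLeast_profile {q t₀ : ℝ} (hq : 0 < q) (ht₀ : 0 < t₀)
    (hne : (reaching q t₀).Nonempty) :
    ∃ a₀ ∈ reaching q t₀, ∀ a ∈ reaching q t₀, profile q a₀ t₀ ≤ profile q a t₀ := by
  obtain ⟨b, hb⟩ := hne
  obtain ⟨ε, hε0, hε⟩ : ∃ ε > 0, ∀ a, 0 < a → a < ε → maxHeight q a < t₀ := by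
    have := (tendsto_maxHeight_zero hq).eventually_lt_const ht₀
    rw [eventually_nhdsWithin_iff, Metric.eventually_nhds_iff] at this
    obtain ⟨ε, hε0, h⟩ := this
    refine ⟨ε, hε0, fun a ha hlt => h ?_ ha⟩
    rwa [dist_zero_right, norm_of_nonneg ha.le]
  have hεle : ∀ a ∈ reaching q t₀, ε ≤ a := by
    intro a ha
    rw [reaching_iff hq ht₀] at ha
    by_contra hlt
    linarith [hε a ha.1 (not_le.1 hlt), ha.2]
  set ρ := profile q b t₀ with hρ
  have hreach : ∀ a ∈ reaching q t₀, reach q a (profile q a t₀) = t₀ := fun a ha => by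
    rw [reach_profile hq ha.1 ha.2, abs_of_pos ht₀]
  set K : Set (ℝ × ℝ) := Icc ε ρ ×ˢ Icc ε ρ with hK
  have hKsub : K ⊆ Ioi 0 ×ˢ Ioi 0 :=
    prod_mono (fun x hx => hε0.trans_le hx.1) (fun x hx => hε0.trans_le hx.1)
  set Z : Set (ℝ × ℝ) := K ∩ (fun p : ℝ × ℝ => reach q p.1 p.2) ⁻¹' Ici t₀ with hZ
  have hZc : IsCompact Z := by
    refine (isCompact_Icc.prod isCompact_Icc).of_isClosed_subset ?_ inter_subset_left
    exact ((continuousOn_reach hq).mono hKsub).preimage_isClosed_of_isClosed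
      (isClosed_Icc.prod isClosed_Icc) isClosed_Ici
  have hmemZ : ∀ a ∈ reaching q t₀, profile q a t₀ ≤ ρ → (a, profile q a t₀) ∈ Z := by
    intro a ha hle
    have h1 := hεle a ha
    have h2 := le_profile hq ha.1 ha.2
    exact ⟨⟨⟨h1, h2.trans hle⟩, h1.trans h2, hle⟩, (hreach a ha).ge⟩
  obtain ⟨⟨a₀, m⟩, hmem, hmin⟩ := hZc.exists_isMinOn ⟨_, hmemZ b hb le_rfl⟩ continuousOn_snd
  obtain ⟨⟨h1, h2⟩, h3⟩ := hmem
  have ha0 : 0 < a₀ := hε0.trans_le h1.1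
  have hm0 : 0 < m := hε0.trans_le h2.1
  have h3 : t₀ ≤ reach q a₀ m := h3
  have hr : a₀ ∈ reaching q t₀ :=
    (reaching_iff hq ht₀).2 ⟨ha0, h3.trans_lt (reach_lt_maxHeight hq ha0 hm0)⟩
  -- The constraint is only an inequality at the minimiser; monotonicity of `reach q a₀` gives the
  -- needed bound.
  have hle : profile q a₀ t₀ ≤ m := by
    by_contra hlt
    push Not at hlt
    have ham : a₀ ≤ m := by
      by_contra hlt'
      rw [reach_eq_zero hq hm0 (not_le.1 hlt').le] at h3
      linarith
    have := strictMonoOn_reach hq ha0 ham (le_profile hq ha0 hr.2) hlt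
    rw [hreach a₀ hr] at this
    linarith
  refine ⟨a₀, hr, fun a ha => hle.trans ?_⟩
  rcases le_total (profile q a t₀) ρ with h | h
  · exact hmin (hmemZ a ha h)
  · exact h2.2.trans h

/-- The boundary radius at height `t₀` has a strict minimum as a function of the neck size. -/
lemma exists_strict_min_profile {q t₀ : ℝ} (hq : 0 < q) (ht₀ : 0 < t₀)
    (hne : (reaching q t₀).Nonempty) :
    ∃ a₀ ∈ reaching q t₀, ∀ a ∈ reaching q t₀, a ≠ a₀ → profile q a₀ t₀ < profile q a t₀ := by
  obtain ⟨a₀, h₀, hmin⟩ := exists_isLeast_profile hq ht₀ hne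
  refine ⟨a₀, h₀, fun a ha hne => lt_of_le_of_ne (hmin a ha) fun heq => ?_⟩
  -- Between two minimisers, the midpoint neck size would have a strictly smaller radius.
  have key : ∀ x y, x ∈ reaching q t₀ → y ∈ reaching q t₀ → x < y →
      profile q x t₀ = profile q a₀ t₀ → profile q y t₀ = profile q a₀ t₀ → False := by
    intro x y hx hy hxy ex ey
    have h := lt_reach_midpoint hq hx.1 hxy ht₀ hx.2 hy.2
    rw [ex, ey, add_self_div_two] at h
    have hc : 0 < (x + y) / 2 := by linarith [hx.1, hy.1]
    obtain ⟨h1, h2⟩ := profile_lt_of_lt_reach hq hc ht₀.le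
      (h₀.1.trans_le (le_profile hq h₀.1 h₀.2)) h
    linarith [hmin _ ⟨hc, h1⟩]
  rcases lt_or_gt_of_ne hne with h | h
  · exact key a a₀ ha h₀ h heq.symm rfl
  · exact key a₀ a h₀ ha h rfl heq.symm

/-- Intermediate values of a ↦ `reach q a R`: above t₀ at a₀, below t₀ for a thin neck, and 0 at a =
R. -/
lemma exists_profile_eq_of_lt {q t₀ a₀ R : ℝ} (hq : 0 < q) (ht₀ : 0 < t₀)
    (h₀ : a₀ ∈ reaching q t₀) (hR : profile q a₀ t₀ < R) :
    (∃ a₁ ∈ reaching q t₀, a₁ < a₀ ∧ profile q a₁ t₀ = R) ∧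
      ∃ a₂ ∈ reaching q t₀, a₀ < a₂ ∧ profile q a₂ t₀ = R := by
  have hle := le_profile hq h₀.1 h₀.2
  have ha0 : 0 < a₀ := h₀.1
  have haR : a₀ < R := hle.trans_lt hR
  have hR0 := ha0.trans haR
  have h1 : t₀ < reach q a₀ R := by
    have := strictMonoOn_reach hq ha0 hle haR.le hR
    rwa [reach_profile hq ha0 h₀.2, abs_of_pos ht₀] at this
  have hc := continuousOn_reach_left hq hR0
  have done : ∀ a, 0 < a → a ≤ R → reach q a R = t₀ →
      a ∈ reaching q t₀ ∧ profile q a t₀ = R := by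
    intro a ha haR' h
    obtain ⟨k1, k2⟩ := profile_eq_of_reach (t := t₀) hq ha haR' (by rw [h, abs_of_pos ht₀])
    exact ⟨⟨ha, k1⟩, k2⟩
  constructor
  · obtain ⟨b, hb, hb0, hba⟩ : ∃ b, maxHeight q b < t₀ ∧ 0 < b ∧ b < a₀ := by
      have e1 := (tendsto_maxHeight_zero hq).eventually_lt_const ht₀
      have e2 : ∀ᶠ b in 𝓝[>] (0 : ℝ), b ∈ Ioo 0 a₀ := Ioo_mem_nhdsGT ha0
      obtain ⟨b, h1, h2⟩ := (e1.and e2).exists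
      exact ⟨b, h1, h2.1, h2.2⟩
    have hb' : reach q b R < t₀ := (reach_lt_maxHeight hq hb0 hR0).trans hb
    obtain ⟨a, ⟨hal, hau⟩, ha⟩ := intermediate_value_Ioo hba.le
      (hc.mono fun x hx => hb0.trans_le hx.1) ⟨hb', h1⟩
    obtain ⟨k1, k2⟩ := done a (hb0.trans hal) (hau.trans haR).le ha
    exact ⟨a, k1, hau, k2⟩
  · have hb' : reach q R R < t₀ := by rwa [reach_eq_zero hq hR0 le_rfl]
    obtain ⟨a, ⟨hal, hau⟩, ha⟩ := intermediate_value_Ioo' haR.le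
      (hc.mono fun x hx => ha0.trans_le hx.1) ⟨hb', h1⟩
    obtain ⟨k1, k2⟩ := done a (ha0.trans hal) hau.le ha
    exact ⟨a, k1, hal, k2⟩

/-! ### Differentials of rotational maps -/

/-- The model of the cylinder `ℝ × S^{n-1}`. -/
noncomputable abbrev cylModel (m : ℕ) : ModelWithCorners ℝ (ℝ × EuclideanSpace ℝ (Fin m))
    (ModelProd ℝ (EuclideanSpace ℝ (Fin m))) := 𝓘(ℝ, ℝ).prod (𝓡 m)

lemma fact_finrank (m : ℕ) : Fact (Module.finrank ℝ (EuclideanSpace ℝ (Fin (m + 1))) = m + 1) :=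
  ⟨finrank_euclideanSpace_fin⟩

lemma contMDiff_sphere_val (m : ℕ) :
    ContMDiff (𝓡 m) 𝓘(ℝ, EuclideanSpace ℝ (Fin (m + 1))) ∞
      (Subtype.val : USphere m → EuclideanSpace ℝ (Fin (m + 1))) :=
  haveI := fact_finrank m
  contMDiff_coe_sphere

/-- The differential of the inclusion of the unit sphere. -/
noncomputable def sphereDiff {m : ℕ} (ζ : USphere m) :
    EuclideanSpace ℝ (Fin m) →L[ℝ] EuclideanSpace ℝ (Fin (m + 1)) :=
  mfderiv (𝓡 m) 𝓘(ℝ, EuclideanSpace ℝ (Fin (m + 1)))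
    (Subtype.val : USphere m → EuclideanSpace ℝ (Fin (m + 1))) ζ

lemma sphereDiff_injective {m : ℕ} (ζ : USphere m) : Function.Injective (sphereDiff ζ) :=
  haveI := fact_finrank m
  injective_mvfderiv_subtypeVal_sphere ζ

lemma range_sphereDiff {m : ℕ} (ζ : USphere m) :
    LinearMap.range (sphereDiff ζ).toLinearMap
      = (Submodule.span ℝ {(ζ : EuclideanSpace ℝ (Fin (m + 1)))})ᗮ :=
  haveI := fact_finrank m
  range_mvfderiv_subtypeVal ζ

lemma inner_sphereDiff {m : ℕ} (ζ : USphere m) (ξ : EuclideanSpace ℝ (Fin m)) :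
    inner ℝ (ζ : EuclideanSpace ℝ (Fin (m + 1))) (sphereDiff ζ ξ) = 0 := by
  have h : sphereDiff ζ ξ ∈ (Submodule.span ℝ {(ζ : EuclideanSpace ℝ (Fin (m + 1)))})ᗮ := by
    rw [← range_sphereDiff]
    exact ⟨ξ, rfl⟩
  exact Submodule.mem_orthogonal_singleton_iff_inner_right.1 h

lemma eq_smul_of_inner_sphereDiff {m : ℕ} (ζ : USphere m) (x : EuclideanSpace ℝ (Fin (m + 1)))
    (h : ∀ ξ, inner ℝ x (sphereDiff ζ ξ) = 0) :
    x = (inner ℝ (ζ : EuclideanSpace ℝ (Fin (m + 1))) x) •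
      (ζ : EuclideanSpace ℝ (Fin (m + 1))) := by
  have hx : x ∈ (Submodule.span ℝ {(ζ : EuclideanSpace ℝ (Fin (m + 1)))})ᗮᗮ := by
    rw [← range_sphereDiff, Submodule.mem_orthogonal']
    rintro _ ⟨ξ, rfl⟩
    exact h ξ
  rw [Submodule.orthogonal_orthogonal, Submodule.mem_span_singleton] at hx
  obtain ⟨c, rfl⟩ := hx
  have hn : ‖(ζ : EuclideanSpace ℝ (Fin (m + 1)))‖ = 1 := norm_eq_of_mem_sphere ζ
  rw [inner_smul_right, real_inner_self_eq_norm_sq, hn]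
  simp

/-- The map `(t, ζ) ↦ (g(t) ζ, k(t))`. -/
def rotMap (m : ℕ) (g k : ℝ → ℝ) (p : ℝ × USphere m) : Coord m :=
  (g p.1 • (p.2 : EuclideanSpace ℝ (Fin (m + 1))), k p.1)

/-- Both the immersion and its standard unit normal are of this form, so one formula serves for both
differentials. -/
lemma diff_rotMap {m : ℕ} {g k : ℝ → ℝ} {g' k' : ℝ} (p : ℝ × USphere m)
    (hg : HasDerivAt g g' p.1) (hk : HasDerivAt k k' p.1)
    (v : ℝ × EuclideanSpace ℝ (Fin m)) :
    diff (cylModel m) (rotMap m g k) p v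
      = ((g' * v.1) • (p.2 : EuclideanSpace ℝ (Fin (m + 1))) + g p.1 • sphereDiff p.2 v.2,
        k' * v.1) := by
  have hι : HasMFDerivAt (𝓡 m) 𝓘(ℝ, EuclideanSpace ℝ (Fin (m + 1)))
      (Subtype.val : USphere m → EuclideanSpace ℝ (Fin (m + 1))) p.2 (sphereDiff p.2) :=
    ((contMDiff_sphere_val m).mdifferentiable (by simp) p.2).hasMFDerivAt
  have h1 := hasMFDerivAt_fst (I := 𝓘(ℝ, ℝ)) (I' := 𝓡 m) p
  have h2 := HasMFDerivAt.comp p hι (hasMFDerivAt_snd (I := 𝓘(ℝ, ℝ)) (I' := 𝓡 m) p)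
  -- The map factors through the inclusion of the cylinder into a vector space, where ordinary
  -- differentiation applies.
  have h3 : HasMFDerivAt (cylModel m) 𝓘(ℝ, ℝ × EuclideanSpace ℝ (Fin (m + 1)))
      (fun p : ℝ × USphere m => (p.1, (p.2 : EuclideanSpace ℝ (Fin (m + 1))))) p
      ((ContinuousLinearMap.fst ℝ ℝ (EuclideanSpace ℝ (Fin m))).prod
        ((sphereDiff p.2).comp (ContinuousLinearMap.snd ℝ ℝ (EuclideanSpace ℝ (Fin m))))) :=
    ⟨h1.1.prodMk h2.1, h1.2.prodMk h2.2⟩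
  have hG : HasFDerivAt
      (fun y : ℝ × EuclideanSpace ℝ (Fin (m + 1)) => ((g y.1 • y.2, k y.1) : Coord m)) _
      (p.1, (p.2 : EuclideanSpace ℝ (Fin (m + 1)))) :=
    ((hg.hasFDerivAt.comp (p.1, (p.2 : EuclideanSpace ℝ (Fin (m + 1))))
      (hasFDerivAt_fst (𝕜 := ℝ))).smul (hasFDerivAt_snd (𝕜 := ℝ))).prodMk
      (hk.hasFDerivAt.comp (p.1, (p.2 : EuclideanSpace ℝ (Fin (m + 1))))
        (hasFDerivAt_fst (𝕜 := ℝ)))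
  have h4 : HasMFDerivAt (cylModel m) 𝓘(ℝ, Coord m) (rotMap m g k) p _ :=
    HasMFDerivAt.comp p hG.hasMFDerivAt h3
  have h5 : diff (cylModel m) (rotMap m g k) p = _ := h4.mfderiv
  rw [h5]
  refine Prod.ext ?_ ?_
  · change g p.1 • sphereDiff p.2 v.2 + (v.1 * g') • (p.2 : EuclideanSpace ℝ (Fin (m + 1))) = _
    rw [mul_comm v.1]
    exact add_comm _ _
  · change v.1 * k' = _
    rw [mul_comm]

lemma contMDiffOn_rotMap {m : ℕ} {g k : ℝ → ℝ} {J : Set ℝ} (hg : ContDiffOn ℝ ∞ g J)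
    (hk : ContDiffOn ℝ ∞ k J) :
    ContMDiffOn (cylModel m) 𝓘(ℝ, Coord m) ∞ (rotMap m g k) (J ×ˢ univ) := by
  have h1 : ContMDiffOn (cylModel m) 𝓘(ℝ, ℝ) ∞ (Prod.fst : ℝ × USphere m → ℝ) (J ×ˢ univ) :=
    contMDiffOn_fst
  have h2 : ContMDiffOn (cylModel m) 𝓘(ℝ, EuclideanSpace ℝ (Fin (m + 1))) ∞
      (fun p : ℝ × USphere m => (p.2 : EuclideanSpace ℝ (Fin (m + 1)))) (J ×ˢ univ) :=
    ((contMDiff_sphere_val m).comp contMDiff_snd).contMDiffOn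
  have hg' := hg.contMDiffOn.comp h1 fun p hp => hp.1
  have hk' := hk.contMDiffOn.comp h1 fun p hp => hp.1
  exact (hg'.smul h2).prodMk_space hk'

/-! ### Metric and Christoffel symbols -/

/-- Only the conformal factor varies; as a function of s = |x|², (2/(1 - s))² has derivative (2/(1 -
s))³. -/
lemma metricDeriv_eq {m : ℕ} {p : Coord m} (hp : ‖p.1‖ < 1) (w u v : Coord m) :
    metricDeriv p w u v
      = 2 * (2 / (1 - ‖p.1‖ ^ 2)) ^ 3 * inner ℝ p.1 w.1 * inner ℝ u.1 v.1 := by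
  have hs : 0 < 1 - ‖p.1‖ ^ 2 := by nlinarith [norm_nonneg p.1]
  have h1 : HasDerivAt (fun s : ℝ => (2 / (1 - s)) ^ 2 * inner ℝ u.1 v.1 + u.2 * v.2)
      ((2 / (1 - ‖p.1‖ ^ 2)) ^ 3 * inner ℝ u.1 v.1) (‖p.1‖ ^ 2) := by
    have h0 : HasDerivAt (fun s : ℝ => 2 / (1 - s)) (2 / (1 - ‖p.1‖ ^ 2) ^ 2) (‖p.1‖ ^ 2) := by
      refine ((hasDerivAt_const _ (2 : ℝ)).div ((hasDerivAt_id (‖p.1‖ ^ 2)).const_sub 1)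
        hs.ne').congr_deriv ?_
      simp
    refine (((h0.pow 2).mul_const _).add_const _).congr_deriv ?_
    norm_num
    left
    field_simp
  have h2 : HasFDerivAt (fun q : Coord m => ‖q.1‖ ^ 2) _ p :=
    (hasFDerivAt_fst (𝕜 := ℝ) (p := p)).norm_sq
  have h3 := h1.hasFDerivAt.comp p h2
  have h4 : fderiv ℝ (fun q : Coord m => metric q u v) p = _ := h3.fderiv
  rw [metricDeriv, h4]
  simp
  ring

lemma christoffel_eq {m : ℕ} {p : Coord m} (hp : ‖p.1‖ < 1) (u v w : Coord m) :
    christoffel p u v w = (2 / (1 - ‖p.1‖ ^ 2)) ^ 3 *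
      (inner ℝ p.1 u.1 * inner ℝ v.1 w.1 + inner ℝ p.1 v.1 * inner ℝ u.1 w.1
        - inner ℝ p.1 w.1 * inner ℝ u.1 v.1) := by
  rw [christoffel, metricDeriv_eq hp, metricDeriv_eq hp, metricDeriv_eq hp]
  ring

lemma eq_zero_of_metric_self {m : ℕ} {p u : Coord m} (hp : ‖p.1‖ < 1)
    (h : metric p u u = 0) : u = 0 := by
  have hs : 0 < 1 - ‖p.1‖ ^ 2 := by nlinarith [norm_nonneg p.1]
  have hμ : 0 < (2 / (1 - ‖p.1‖ ^ 2)) ^ 2 := by positivity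
  rw [metric, real_inner_self_eq_norm_sq] at h
  have h1 := mul_nonneg hμ.le (sq_nonneg ‖u.1‖)
  have h2 : u.2 = 0 := by nlinarith [mul_self_nonneg u.2]
  have h3 : ‖u.1‖ = 0 := by
    rw [h2, mul_zero, add_zero] at h
    simpa using (mul_eq_zero.1 h).resolve_left hμ.ne'
  exact Prod.ext (norm_eq_zero.1 h3) h2

/-! ### First and second fundamental forms of rotational maps -/

section

variable {m : ℕ} (ζ : USphere m)

lemma inner_rot (a b c d : ℝ) (ξ η : EuclideanSpace ℝ (Fin m)) :
    inner ℝ (a • (ζ : EuclideanSpace ℝ (Fin (m + 1))) + b • sphereDiff ζ ξ)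
      (c • (ζ : EuclideanSpace ℝ (Fin (m + 1))) + d • sphereDiff ζ η)
      = a * c + b * d * inner ℝ (sphereDiff ζ ξ) (sphereDiff ζ η) := by
  have hn : ‖(ζ : EuclideanSpace ℝ (Fin (m + 1)))‖ = 1 := norm_eq_of_mem_sphere ζ
  have h1 := inner_sphereDiff ζ η
  have h2 := inner_sphereDiff ζ ξ
  rw [real_inner_comm] at h2
  simp only [inner_add_left, inner_add_right, real_inner_smul_left, real_inner_smul_right,
    real_inner_self_eq_norm_sq, hn, h1, h2]
  ring

lemma inner_rot_left (a c d : ℝ) (η : EuclideanSpace ℝ (Fin m)) :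
    inner ℝ (a • (ζ : EuclideanSpace ℝ (Fin (m + 1))))
      (c • (ζ : EuclideanSpace ℝ (Fin (m + 1))) + d • sphereDiff ζ η) = a * c := by
  simpa using inner_rot ζ a 0 c d 0 η

end

lemma norm_rotMap_fst {m : ℕ} (g k : ℝ → ℝ) (p : ℝ × USphere m) :
    ‖(rotMap m g k p).1‖ = |g p.1| := by
  have hn : ‖(p.2 : EuclideanSpace ℝ (Fin (m + 1)))‖ = 1 := norm_eq_of_mem_sphere p.2
  rw [rotMap, norm_smul, hn, mul_one, Real.norm_eq_abs]

lemma metric_diff_rotMap {m : ℕ} {g k h l : ℝ → ℝ} {g' k' h' l' : ℝ} (G K : ℝ → ℝ)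
    (p : ℝ × USphere m)
    (hg : HasDerivAt g g' p.1) (hk : HasDerivAt k k' p.1)
    (hh : HasDerivAt h h' p.1) (hl : HasDerivAt l l' p.1)
    (u v : ℝ × EuclideanSpace ℝ (Fin m)) :
    metric (rotMap m G K p) (diff (cylModel m) (rotMap m g k) p u)
        (diff (cylModel m) (rotMap m h l) p v)
      = ((2 / (1 - G p.1 ^ 2)) ^ 2 * (g' * h') + k' * l') * (u.1 * v.1)
        + (2 / (1 - G p.1 ^ 2)) ^ 2 * (g p.1 * h p.1)
          * inner ℝ (sphereDiff p.2 u.2) (sphereDiff p.2 v.2) := by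
  rw [metric, norm_rotMap_fst, sq_abs, diff_rotMap p hg hk, diff_rotMap p hh hl, inner_rot]
  ring

lemma secondFundamentalForm_rotMap {m : ℕ} {g k h l : ℝ → ℝ} {g' k' h' l' : ℝ}
    (p : ℝ × USphere m) (hlt : |g p.1| < 1)
    (hg : HasDerivAt g g' p.1) (hk : HasDerivAt k k' p.1)
    (hh : HasDerivAt h h' p.1) (hl : HasDerivAt l l' p.1) {N : ℝ × USphere m → Coord m}
    (hN : N =ᶠ[𝓝 p] rotMap m h l)
    (u v : ℝ × EuclideanSpace ℝ (Fin m)) :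
    secondFundamentalForm (cylModel m) (rotMap m g k) N p u v
      = -(((2 / (1 - g p.1 ^ 2)) ^ 2 * (h' * g') + l' * k'
            + (2 / (1 - g p.1 ^ 2)) ^ 3 * (g p.1 * h p.1 * g' ^ 2)) * (u.1 * v.1)
        + ((2 / (1 - g p.1 ^ 2)) ^ 2 * (h p.1 * g p.1)
            + (2 / (1 - g p.1 ^ 2)) ^ 3 * (g p.1 * h p.1 * g p.1 ^ 2))
          * inner ℝ (sphereDiff p.2 u.2) (sphereDiff p.2 v.2)) := by
  have hd : diff (cylModel m) N p = diff (cylModel m) (rotMap m h l) p := hN.mfderiv_eq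
  have hNp : N p = rotMap m h l p := hN.eq_of_nhds
  rw [secondFundamentalForm, hd, hNp, metric_diff_rotMap g k p hh hl hg hk,
    christoffel_eq (by rwa [norm_rotMap_fst]), norm_rotMap_fst, sq_abs, diff_rotMap p hg hk,
    diff_rotMap p hg hk]
  have e1 : (rotMap m g k p).1 = g p.1 • (p.2 : EuclideanSpace ℝ (Fin (m + 1))) := rfl
  have e2 : (rotMap m h l p).1 = h p.1 • (p.2 : EuclideanSpace ℝ (Fin (m + 1))) := rfl
  have e3 : inner ℝ (g p.1 • (p.2 : EuclideanSpace ℝ (Fin (m + 1))))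
      (h p.1 • (p.2 : EuclideanSpace ℝ (Fin (m + 1)))) = g p.1 * h p.1 := by
    simpa using inner_rot_left p.2 (g p.1) (h p.1) 0 0
  have e4 : ∀ c d η, inner ℝ (c • (p.2 : EuclideanSpace ℝ (Fin (m + 1))) + d • sphereDiff p.2 η)
      (h p.1 • (p.2 : EuclideanSpace ℝ (Fin (m + 1)))) = h p.1 * c := fun c d η => by
    rw [real_inner_comm, inner_rot_left]
  simp only [e1, e2, e3, e4, inner_rot_left, inner_rot]
  ring

/-! ### The symmetric functions of the principal curvatures -/

lemma esymm_replicate (k : ℝ) (m j : ℕ) :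
    (Multiset.replicate m k).esymm j = m.choose j * k ^ j := by
  have h : (Multiset.powersetCard j (Multiset.replicate m k)).map Multiset.prod
      = Multiset.replicate (m.choose j) (k ^ j) := by
    rw [Multiset.eq_replicate]
    refine ⟨by simp, fun b hb => ?_⟩
    obtain ⟨t, ht, rfl⟩ := Multiset.mem_map.1 hb
    obtain ⟨hle, hcard⟩ := Multiset.mem_powersetCard.1 ht
    have : t = Multiset.replicate j k :=
      Multiset.eq_replicate.2 ⟨hcard, fun b hb =>
        Multiset.eq_of_mem_replicate (Multiset.mem_of_le hle hb)⟩
    rw [this, Multiset.prod_replicate]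
  rw [Multiset.esymm, h, Multiset.sum_replicate, nsmul_eq_mul]

/-- The (r + 1)-element sub-multisets are split according to whether they use the distinguished
entry k₀. -/
lemma esymm_cons_replicate (k₀ k : ℝ) (m r : ℕ) :
    (k₀ ::ₘ Multiset.replicate m k).esymm (r + 1)
      = m.choose (r + 1) * k ^ (r + 1) + k₀ * (m.choose r * k ^ r) := by
  rw [← esymm_replicate, ← esymm_replicate, Multiset.esymm, Multiset.powersetCard_cons,
    Multiset.map_add, Multiset.sum_add, Multiset.map_map]
  congr 1
  rw [Multiset.esymm, ← Multiset.sum_map_mul_left]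
  simp

lemma charpoly_smul_id {M : Type*} [AddCommGroup M] [Module ℝ M] [Module.Finite ℝ M] (k : ℝ) :
    (k • (LinearMap.id : M →ₗ[ℝ] M)).charpoly
      = (Polynomial.X - Polynomial.C k) ^ Module.finrank ℝ M := by
  have h : k • (LinearMap.id : M →ₗ[ℝ] M) = (1 : Module.End ℝ M) - (1 - k) • 1 := by
    rw [sub_smul, one_smul, sub_sub_cancel]; rfl
  rw [h, LinearMap.charpoly_sub_smul, LinearMap.charpoly_one]
  simp only [Polynomial.pow_comp, Polynomial.sub_comp, Polynomial.X_comp, Polynomial.one_comp]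
  congr 1
  simp only [map_sub, map_one]
  ring

/-- The operator with eigenvalue `k₀` along the profile curve and `k` along the parallels. -/
noncomputable def diagOp (m : ℕ) (k₀ k : ℝ) :
    (ℝ × EuclideanSpace ℝ (Fin m)) →ₗ[ℝ] (ℝ × EuclideanSpace ℝ (Fin m)) :=
  (k₀ • LinearMap.id).prodMap (k • LinearMap.id)

lemma roots_charpoly_diagOp (m : ℕ) (k₀ k : ℝ) :
    (diagOp m k₀ k).charpoly.roots = k₀ ::ₘ Multiset.replicate m k := by
  rw [diagOp, LinearMap.charpoly_prodMap, charpoly_smul_id, charpoly_smul_id,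
    Module.finrank_self, pow_one, finrank_euclideanSpace_fin,
    Polynomial.roots_mul (mul_ne_zero (Polynomial.X_sub_C_ne_zero _)
      (pow_ne_zero _ (Polynomial.X_sub_C_ne_zero _))),
    Polynomial.roots_X_sub_C, Polynomial.roots_pow, Polynomial.roots_X_sub_C,
    Multiset.nsmul_singleton]
  rfl

/-- The quotient of the binomials (m choose r + 1) and (m choose r) is (m - r)/(r + 1) = q for n = m
+ 1, so the symmetric function is a multiple of k^r (k₀ + q k). -/
lemma meanCurvature_diagOp_eq_zero_iff {m r : ℕ} (hr : r + 1 < m + 1) {k₀ k : ℝ} (hk : k ≠ 0) :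
    meanCurvature (diagOp m k₀ k) (r + 1) = 0 ↔ k₀ = -(qExp (m + 1) r * k) := by
  have hfin : Module.finrank ℝ (ℝ × EuclideanSpace ℝ (Fin m)) = m + 1 := by
    rw [Module.finrank_prod, Module.finrank_self, finrank_euclideanSpace_fin, add_comm]
  have h1 : ((m + 1).choose (r + 1) : ℝ) ≠ 0 :=
    Nat.cast_ne_zero.2 (Nat.choose_pos hr.le).ne'
  have h2 : (m.choose r : ℝ) ≠ 0 := Nat.cast_ne_zero.2 (Nat.choose_pos (by omega)).ne'
  have h3 : (m.choose (r + 1) : ℝ) = m.choose r * qExp (m + 1) r := by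
    have h := Nat.choose_succ_right_eq m r
    have h' : (m.choose (r + 1) : ℝ) * (r + 1) = m.choose r * (m - r) := by
      have h'' := congrArg (Nat.cast : ℕ → ℝ) h
      push_cast [Nat.cast_sub (show r ≤ m by omega)] at h''
      exact h''
    have h4 : (r + 1 : ℝ) ≠ 0 := by positivity
    rw [qExp]
    push_cast
    field_simp
    rw [h']
    ring
  rw [meanCurvature, roots_charpoly_diagOp, hfin, div_eq_zero_iff, or_iff_left h1,
    esymm_cons_replicate, h3, pow_succ]
  have h4 : (m.choose r : ℝ) * qExp (m + 1) r * (k ^ r * k) + k₀ * (m.choose r * k ^ r)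
      = m.choose r * k ^ r * (k₀ + qExp (m + 1) r * k) := by ring
  rw [h4, mul_eq_zero, or_iff_right (mul_ne_zero h2 (pow_ne_zero _ hk)), add_eq_zero_iff_eq_neg]

/-! ### Rotational hypersurfaces -/

lemma tanh_half (x : ℝ) : tanh (x / 2) = sinh x / (1 + cosh x) := by
  have h2 : x = 2 * (x / 2) := by ring
  have hs : sinh x = 2 * sinh (x / 2) * cosh (x / 2) := by
    conv_lhs => rw [h2, sinh_two_mul]
  have hc : 1 + cosh x = 2 * cosh (x / 2) ^ 2 := by
    have : cosh x = cosh (x / 2) ^ 2 + sinh (x / 2) ^ 2 := by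
      conv_lhs => rw [h2, cosh_two_mul]
    linarith [cosh_sq (x / 2)]
  have := cosh_pos (x / 2)
  rw [hs, hc, tanh_eq_sinh_div_cosh]
  field_simp

lemma abs_tanh_half_lt_one (x : ℝ) : |tanh (x / 2)| < 1 := abs_tanh_lt_one _

lemma conformal_factor_tanh_half (x : ℝ) : 2 / (1 - tanh (x / 2) ^ 2) = 1 + cosh x := by
  have hc : 0 < 1 + cosh x := by linarith [cosh_pos x]
  have h : 1 - tanh (x / 2) ^ 2 = 2 / (1 + cosh x) := by
    rw [tanh_half]
    have := cosh_sq x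
    field_simp
    linarith
  rw [h, div_div_eq_mul_div, mul_div_assoc, mul_comm, div_mul_cancel₀ _ two_ne_zero]

lemma hasDerivAt_tanh_half {f : ℝ → ℝ} {p t : ℝ} (hf : HasDerivAt f p t) :
    HasDerivAt (fun t => tanh (f t / 2)) (p / (1 + cosh (f t))) t := by
  have h1 : (fun t => tanh (f t / 2)) = fun t => sinh (f t) / (1 + cosh (f t)) :=
    funext fun t => tanh_half _
  have hc : 0 < 1 + cosh (f t) := by linarith [cosh_pos (f t)]
  rw [h1]
  refine (hf.sinh.div (hf.cosh.const_add 1) hc.ne').congr_deriv ?_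
  have := cosh_sq (f t)
  field_simp
  linear_combination p * this

lemma rotParam_eq_rotMap (m : ℕ) (f : ℝ → ℝ) :
    rotParam m f = rotMap m (fun t => tanh (f t / 2)) id := rfl

lemma inner_self_USphere {m : ℕ} (ζ : USphere m) :
    inner ℝ (ζ : EuclideanSpace ℝ (Fin (m + 1))) (ζ : EuclideanSpace ℝ (Fin (m + 1))) = 1 := by
  have hn : ‖(ζ : EuclideanSpace ℝ (Fin (m + 1)))‖ = 1 := norm_eq_of_mem_sphere ζ
  rw [real_inner_self_eq_norm_sq, hn, one_pow]

/-- Radial coefficient of the unit normal of a rotational hypersurface. -/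
noncomputable def normalRadial (f : ℝ → ℝ) (t : ℝ) : ℝ :=
  1 / ((1 + cosh (f t)) * √(1 + deriv f t ^ 2))

/-- Axial component of the unit normal of a rotational hypersurface. -/
noncomputable def normalAxial (f : ℝ → ℝ) (t : ℝ) : ℝ :=
  -(deriv f t / √(1 + deriv f t ^ 2))

section

variable {f : ℝ → ℝ} {t s : ℝ}

lemma hasDerivAt_sqrt_one_add_sq (hp : HasDerivAt (deriv f) s t) :
    HasDerivAt (fun t => √(1 + deriv f t ^ 2))
      (deriv f t * s / √(1 + deriv f t ^ 2)) t := by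
  have h0 : (0 : ℝ) < 1 + deriv f t ^ 2 := by positivity
  refine (((hp.pow 2).const_add 1).sqrt h0.ne').congr_deriv ?_
  norm_num
  field_simp

lemma hasDerivAt_normalRadial (hf : HasDerivAt f (deriv f t) t) (hp : HasDerivAt (deriv f) s t) :
    HasDerivAt (normalRadial f)
      (-(sinh (f t) * deriv f t * √(1 + deriv f t ^ 2)
        + (1 + cosh (f t)) * (deriv f t * s / √(1 + deriv f t ^ 2)))
        / ((1 + cosh (f t)) * √(1 + deriv f t ^ 2)) ^ 2) t := by
  have hc : 0 < 1 + cosh (f t) := by linarith [cosh_pos (f t)]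
  have hW : 0 < √(1 + deriv f t ^ 2) := by positivity
  refine ((hasDerivAt_const t (1 : ℝ)).div
    ((hf.cosh.const_add 1).mul (hasDerivAt_sqrt_one_add_sq hp)) (mul_pos hc hW).ne').congr_deriv ?_
  simp only [zero_mul, one_mul, zero_sub, Pi.mul_apply]

lemma hasDerivAt_normalAxial (hp : HasDerivAt (deriv f) s t) :
    HasDerivAt (normalAxial f) (-(s / √(1 + deriv f t ^ 2) ^ 3)) t := by
  have hW : 0 < √(1 + deriv f t ^ 2) := by positivity
  have hW2 : √(1 + deriv f t ^ 2) ^ 2 = 1 + deriv f t ^ 2 := Real.sq_sqrt (by positivity)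
  refine ((hp.div (hasDerivAt_sqrt_one_add_sq hp) hW.ne').neg).congr_deriv ?_
  field_simp
  rw [hW2]
  ring

end

/-- A smooth, positive generating function. -/
structure IsGenerator (f : ℝ → ℝ) (J : Set ℝ) : Prop where
  isOpen : IsOpen J
  smooth : ContDiffOn ℝ ∞ f J
  pos : ∀ t ∈ J, 0 < f t

namespace IsGenerator

variable {f : ℝ → ℝ} {J : Set ℝ} {t : ℝ}

lemma smooth_deriv (h : IsGenerator f J) : ContDiffOn ℝ ∞ (deriv f) J :=
  ((contDiffOn_infty_iff_deriv_of_isOpen h.isOpen).1 h.smooth).2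

lemma hasDerivAt (h : IsGenerator f J) (ht : t ∈ J) : HasDerivAt f (deriv f t) t :=
  ((h.smooth.contDiffAt (h.isOpen.mem_nhds ht)).differentiableAt (by simp)).hasDerivAt

lemma hasDerivAt_deriv (h : IsGenerator f J) (ht : t ∈ J) :
    HasDerivAt (deriv f) (deriv (deriv f) t) t :=
  ((h.smooth_deriv.contDiffAt (h.isOpen.mem_nhds ht)).differentiableAt (by simp)).hasDerivAt

end IsGenerator

section

variable {m : ℕ} {f : ℝ → ℝ} {p : ℝ × USphere m} {s : ℝ}

lemma metric_diff_rotParam (hf : HasDerivAt f (deriv f p.1) p.1)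
    (u v : ℝ × EuclideanSpace ℝ (Fin m)) :
    metric (rotParam m f p) (diff (cylModel m) (rotParam m f) p u)
        (diff (cylModel m) (rotParam m f) p v)
      = (1 + deriv f p.1 ^ 2) * (u.1 * v.1)
        + sinh (f p.1) ^ 2 * inner ℝ (sphereDiff p.2 u.2) (sphereDiff p.2 v.2) := by
  have hc : 0 < 1 + cosh (f p.1) := by linarith [cosh_pos (f p.1)]
  have hX := hasDerivAt_tanh_half hf
  rw [rotParam_eq_rotMap, metric_diff_rotMap _ _ p hX (hasDerivAt_id _) hX (hasDerivAt_id _),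
    conformal_factor_tanh_half, tanh_half]
  field_simp
  ring

lemma diff_rotParam_injective (hf : HasDerivAt f (deriv f p.1) p.1) (hpos : 0 < f p.1) :
    Function.Injective (diff (cylModel m) (rotParam m f) p) := by
  rw [injective_iff_map_eq_zero]
  intro u hu
  have h := metric_diff_rotParam hf u u
  rw [hu] at h
  have h0 : metric (rotParam m f p) (0 : Coord m) 0 = 0 := by simp [metric]
  rw [h0, real_inner_self_eq_norm_sq] at h
  have hs : 0 < sinh (f p.1) ^ 2 := pow_pos (sinh_pos_iff.2 hpos) 2
  have hA : 0 ≤ (1 + deriv f p.1 ^ 2) * (u.1 * u.1) :=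
    mul_nonneg (by positivity) (mul_self_nonneg _)
  have hB : 0 ≤ sinh (f p.1) ^ 2 * ‖sphereDiff p.2 u.2‖ ^ 2 := by positivity
  have h1 : u.1 = 0 := by
    have : (1 + deriv f p.1 ^ 2) * (u.1 * u.1) = 0 := by linarith
    have hne : (1 + deriv f p.1 ^ 2) ≠ 0 := by positivity
    exact mul_self_eq_zero.1 ((mul_eq_zero.1 this).resolve_left hne)
  have h2 : sphereDiff p.2 u.2 = 0 := by
    have : sinh (f p.1) ^ 2 * ‖sphereDiff p.2 u.2‖ ^ 2 = 0 := by linarith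
    simpa using (mul_eq_zero.1 this).resolve_left hs.ne'
  exact Prod.ext h1 ((injective_iff_map_eq_zero _).1 (sphereDiff_injective p.2) _ h2)

lemma secondFundamentalForm_rotParam (hf : HasDerivAt f (deriv f p.1) p.1)
    (hp : HasDerivAt (deriv f) s p.1) (ε : ℝ) {N : ℝ × USphere m → Coord m}
    (hN : N =ᶠ[𝓝 p] rotMap m (fun t => ε * normalRadial f t) (fun t => ε * normalAxial f t))
    (u v : ℝ × EuclideanSpace ℝ (Fin m)) :
    secondFundamentalForm (cylModel m) (rotParam m f) N p u v
      = ε * (s / √(1 + deriv f p.1 ^ 2)) * (u.1 * v.1)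
        - ε * (sinh (f p.1) * cosh (f p.1) / √(1 + deriv f p.1 ^ 2))
          * inner ℝ (sphereDiff p.2 u.2) (sphereDiff p.2 v.2) := by
  have hc : 0 < 1 + cosh (f p.1) := by linarith [cosh_pos (f p.1)]
  have hW : 0 < √(1 + deriv f p.1 ^ 2) := by positivity
  have hW2 : √(1 + deriv f p.1 ^ 2) ^ 2 = 1 + deriv f p.1 ^ 2 := Real.sq_sqrt (by positivity)
  have hX := hasDerivAt_tanh_half hf
  rw [rotParam_eq_rotMap, secondFundamentalForm_rotMap p (abs_tanh_half_lt_one _) hX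
    (hasDerivAt_id _) ((hasDerivAt_normalRadial hf hp).const_mul ε)
    ((hasDerivAt_normalAxial hp).const_mul ε) hN,
    conformal_factor_tanh_half, tanh_half, normalRadial]
  set W := √(1 + deriv f p.1 ^ 2)
  set C := cosh (f p.1)
  set S := sinh (f p.1)
  set d := deriv f p.1
  have hCS : S ^ 2 = C ^ 2 - 1 := by have := cosh_sq (f p.1); simp only [C, S]; linarith
  have e1 : (1 + C) ^ 2 * (ε * (-(S * d * W + (1 + C) * (d * s / W)) / ((1 + C) * W) ^ 2)
        * (d / (1 + C))) + ε * -(s / W ^ 3) * 1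
        + (1 + C) ^ 3 * (S / (1 + C) * (ε * (1 / ((1 + C) * W))) * (d / (1 + C)) ^ 2)
      = -(ε * (s / W)) := by
    have : s / W = s * (1 + d ^ 2) / W ^ 3 := by rw [← hW2]; field_simp
    rw [this]
    field_simp
    ring
  have e2 : (1 + C) ^ 2 * (ε * (1 / ((1 + C) * W)) * (S / (1 + C)))
        + (1 + C) ^ 3 * (S / (1 + C) * (ε * (1 / ((1 + C) * W))) * (S / (1 + C)) ^ 2)
      = ε * (S * C / W) := by
    field_simp
    rw [hCS]
    ring
  rw [e1, e2]
  ring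

/-- Both fundamental forms are diagonal in the splitting of the tangent space, which gives the
operator; nondegeneracy of the induced metric makes it unique. -/
lemma isShapeOperatorAt_rotParam_iff (hf : HasDerivAt f (deriv f p.1) p.1) (hpos : 0 < f p.1)
    (hp : HasDerivAt (deriv f) s p.1) (ε : ℝ) {N : ℝ × USphere m → Coord m}
    (hN : N =ᶠ[𝓝 p] rotMap m (fun t => ε * normalRadial f t) (fun t => ε * normalAxial f t))
    (A : (ℝ × EuclideanSpace ℝ (Fin m)) →ₗ[ℝ] (ℝ × EuclideanSpace ℝ (Fin m))) :
    IsShapeOperatorAt (cylModel m) (rotParam m f) N p A ↔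
      A = diagOp m (ε * (s / √(1 + deriv f p.1 ^ 2) ^ 3))
        (-(ε * (cosh (f p.1) / (sinh (f p.1) * √(1 + deriv f p.1 ^ 2))))) := by
  have hW : 0 < √(1 + deriv f p.1 ^ 2) := by positivity
  have hW2 : √(1 + deriv f p.1 ^ 2) ^ 2 = 1 + deriv f p.1 ^ 2 := Real.sq_sqrt (by positivity)
  have hS : 0 < sinh (f p.1) := sinh_pos_iff.2 hpos
  set B := diagOp m (ε * (s / √(1 + deriv f p.1 ^ 2) ^ 3))
        (-(ε * (cosh (f p.1) / (sinh (f p.1) * √(1 + deriv f p.1 ^ 2))))) with hB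
  have hBshape : IsShapeOperatorAt (cylModel m) (rotParam m f) N p B := by
    intro u v
    have h1 : (B u).1 = ε * (s / √(1 + deriv f p.1 ^ 2) ^ 3) * u.1 := rfl
    have h2 : (B u).2 = (-(ε * (cosh (f p.1) / (sinh (f p.1) * √(1 + deriv f p.1 ^ 2))))) • u.2 :=
      rfl
    rw [metric_diff_rotParam hf, secondFundamentalForm_rotParam hf hp ε hN, h1, h2, map_smul,
      real_inner_smul_left]
    set W := √(1 + deriv f p.1 ^ 2)
    rw [← hW2]
    field_simp
    ring
  refine ⟨fun h => LinearMap.ext fun u => ?_, fun h => h ▸ hBshape⟩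
  have key : ∀ v, metric (rotParam m f p) (diff (cylModel m) (rotParam m f) p (A u - B u))
      (diff (cylModel m) (rotParam m f) p v) = 0 := by
    intro v
    have h1 := h u v
    rw [← hBshape u v] at h1
    rw [map_sub]
    simp only [metric, Prod.fst_sub, Prod.snd_sub, inner_sub_left] at h1 ⊢
    linarith
  have hlt : ‖(rotParam m f p).1‖ < 1 := by
    rw [rotParam_eq_rotMap, norm_rotMap_fst]
    exact abs_tanh_half_lt_one _
  have h0 := eq_zero_of_metric_self hlt (key (A u - B u))
  exact sub_eq_zero.1 ((injective_iff_map_eq_zero _).1 (diff_rotParam_injective hf hpos) _ h0)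

lemma isUnitNormalAt_rotParam (hf : HasDerivAt f (deriv f p.1) p.1) :
    IsUnitNormalAt (cylModel m) (rotParam m f)
      (rotMap m (normalRadial f) (normalAxial f)) p := by
  have hc : 0 < 1 + cosh (f p.1) := by linarith [cosh_pos (f p.1)]
  have hW : 0 < √(1 + deriv f p.1 ^ 2) := by positivity
  have hW2 : √(1 + deriv f p.1 ^ 2) ^ 2 = 1 + deriv f p.1 ^ 2 := Real.sq_sqrt (by positivity)
  have hX := hasDerivAt_tanh_half hf
  have hn := inner_self_USphere p.2
  constructor
  · rw [rotParam_eq_rotMap, metric, norm_rotMap_fst, sq_abs, conformal_factor_tanh_half]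
    simp only [rotMap, real_inner_smul_left, real_inner_smul_right, hn,
      normalRadial, normalAxial]
    field_simp
    rw [hW2]
  · intro v
    rw [rotParam_eq_rotMap, metric, norm_rotMap_fst, sq_abs, conformal_factor_tanh_half,
      diff_rotMap p hX (hasDerivAt_id _)]
    simp only [rotMap, inner_rot_left, normalRadial, normalAxial]
    field_simp
    ring

/-- The coefficient of a unit normal with respect to the standard one. -/
noncomputable def normalCoeff (m : ℕ) (f : ℝ → ℝ) (N : ℝ × USphere m → Coord m)
    (p : ℝ × USphere m) : ℝ :=
  inner ℝ (p.2 : EuclideanSpace ℝ (Fin (m + 1))) (N p).1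
    * ((1 + cosh (f p.1)) * √(1 + deriv f p.1 ^ 2))

/-- Orthogonality to the parallels makes the horizontal part radial, orthogonality to the profile
curve fixes the direction, and unit length leaves only a sign. -/
lemma IsUnitNormalAt.eq_rotMap {N : ℝ × USphere m → Coord m}
    (hf : HasDerivAt f (deriv f p.1) p.1) (hpos : 0 < f p.1)
    (h : IsUnitNormalAt (cylModel m) (rotParam m f) N p) :
    normalCoeff m f N p ^ 2 = 1 ∧
      N p = ((normalCoeff m f N p * normalRadial f p.1) •
        (p.2 : EuclideanSpace ℝ (Fin (m + 1))), normalCoeff m f N p * normalAxial f p.1) := by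
  obtain ⟨hu, ho⟩ := h
  have hc : 0 < 1 + cosh (f p.1) := by linarith [cosh_pos (f p.1)]
  have hW : 0 < √(1 + deriv f p.1 ^ 2) := by positivity
  have hW2 : √(1 + deriv f p.1 ^ 2) ^ 2 = 1 + deriv f p.1 ^ 2 := Real.sq_sqrt (by positivity)
  have hS : 0 < sinh (f p.1) := sinh_pos_iff.2 hpos
  have hX := hasDerivAt_tanh_half hf
  have hn := inner_self_USphere p.2
  rw [rotParam_eq_rotMap] at hu ho
  rw [metric, norm_rotMap_fst, sq_abs, conformal_factor_tanh_half] at hu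
  have hx : ∀ ξ, inner ℝ (N p).1 (sphereDiff p.2 ξ) = 0 := by
    intro ξ
    have h1 := ho (0, ξ)
    rw [metric, norm_rotMap_fst, sq_abs, conformal_factor_tanh_half,
      diff_rotMap p hX (hasDerivAt_id _), tanh_half] at h1
    simp only [mul_zero, zero_smul, zero_add, add_zero, real_inner_smul_right] at h1
    have hne : (1 + cosh (f p.1)) ^ 2 * (sinh (f p.1) / (1 + cosh (f p.1))) ≠ 0 := by positivity
    rw [← mul_assoc] at h1
    exact (mul_eq_zero.1 h1).resolve_left hne
  have hrad := eq_smul_of_inner_sphereDiff p.2 _ hx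
  set α := inner ℝ (p.2 : EuclideanSpace ℝ (Fin (m + 1))) (N p).1 with hα
  have hy : (N p).2 = -((1 + cosh (f p.1)) * α * deriv f p.1) := by
    have h1 := ho (1, 0)
    rw [metric, norm_rotMap_fst, sq_abs, conformal_factor_tanh_half,
      diff_rotMap p hX (hasDerivAt_id _)] at h1
    simp only [map_zero, smul_zero, add_zero, mul_one, real_inner_smul_right] at h1
    rw [real_inner_comm, ← hα] at h1
    field_simp at h1
    linarith
  rw [hy, hrad] at hu
  simp only [real_inner_smul_left, real_inner_smul_right, hn] at hu
  have hco : normalCoeff m f N p = α * ((1 + cosh (f p.1)) * √(1 + deriv f p.1 ^ 2)) := rfl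
  refine ⟨?_, ?_⟩
  · rw [hco, mul_pow, mul_pow, hW2]
    linarith
  · rw [hco]
    refine Prod.ext ?_ ?_
    · rw [hrad]
      congr 1
      rw [normalRadial]
      field_simp
    · rw [hy]
      simp only [normalAxial]
      field_simp

end

/-- The sign relating two unit normals is continuous, hence locally constant. Agreement near p, not
just at p, is what allows N to be differentiated there. -/
lemma IsGenerator.eventuallyEq_rotMap {m : ℕ} {f : ℝ → ℝ} {J : Set ℝ} (h : IsGenerator f J)
    {N : ℝ × USphere m → Coord m}
    (hN : ContinuousOn N (J ×ˢ univ))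
    (hu : ∀ p ∈ J ×ˢ (univ : Set (USphere m)), IsUnitNormalAt (cylModel m) (rotParam m f) N p)
    {p : ℝ × USphere m} (hp : p.1 ∈ J) :
    ∃ ε : ℝ, ε ≠ 0 ∧ N =ᶠ[𝓝 p]
      rotMap m (fun t => ε * normalRadial f t) (fun t => ε * normalAxial f t) := by
  have hU : J ×ˢ (univ : Set (USphere m)) ∈ 𝓝 p :=
    (h.isOpen.prod isOpen_univ).mem_nhds ⟨hp, mem_univ _⟩
  have hcont : ContinuousAt (normalCoeff m f N) p := by
    have c1 : ContinuousAt (fun p : ℝ × USphere m => f p.1) p :=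
      (h.hasDerivAt hp).continuousAt.comp (f := Prod.fst) continuousAt_fst
    have c2 : ContinuousAt (fun p : ℝ × USphere m => deriv f p.1) p :=
      (h.hasDerivAt_deriv hp).continuousAt.comp (f := Prod.fst) continuousAt_fst
    have c3 : ContinuousAt N p := hN.continuousAt hU
    have c4 : ContinuousAt (fun p : ℝ × USphere m => (N p).1) p := c3.fst
    have c5 : ContinuousAt
        (fun p : ℝ × USphere m => (p.2 : EuclideanSpace ℝ (Fin (m + 1)))) p := by fun_prop
    exact (ContinuousAt.inner (𝕜 := ℝ) c5 c4).mul
      ((continuousAt_const.add (continuous_cosh.continuousAt.comp c1)).mul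
        ((continuousAt_const.add (c2.pow 2)).sqrt))
  have hval : ∀ p' ∈ J ×ˢ (univ : Set (USphere m)), _ := fun p' hp' =>
    (hu p' hp').eq_rotMap (h.hasDerivAt hp'.1) (h.pos _ hp'.1)
  have h0 := (hval p ⟨hp, mem_univ _⟩).1
  refine ⟨normalCoeff m f N p, fun h => by rw [h] at h0; norm_num at h0, ?_⟩
  -- Opposite signs are at distance 2, so closeness within 1 forces equality.
  have hball := Metric.continuousAt_iff'.1 hcont 1 one_pos
  filter_upwards [hU, hball] with p' hp' hd
  obtain ⟨hsq, heq⟩ := hval p' hp'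
  have : normalCoeff m f N p' = normalCoeff m f N p := by
    rw [Real.dist_eq, abs_lt] at hd
    have hmul : (normalCoeff m f N p' - normalCoeff m f N p)
        * (normalCoeff m f N p' + normalCoeff m f N p) = 0 := by linear_combination hsq - h0
    rcases mul_eq_zero.1 hmul with h1 | h1
    · exact sub_eq_zero.1 h1
    · nlinarith
  rw [heq, this]
  rfl

instance nonempty_USphere (m : ℕ) : Nonempty (USphere m) :=
  ⟨⟨EuclideanSpace.single 0 1, by simp⟩⟩

lemma mean_curvature_equation_iff {q y p s ε : ℝ} (hy : 0 < y) (hε : ε ≠ 0) :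
    ε * (s / √(1 + p ^ 2) ^ 3) = -(q * -(ε * (cosh y / (sinh y * √(1 + p ^ 2))))) ↔
      s = q * (cosh y / sinh y) * (1 + p ^ 2) := by
  have hW : 0 < √(1 + p ^ 2) := by positivity
  have hW2 : √(1 + p ^ 2) ^ 2 = 1 + p ^ 2 := Real.sq_sqrt (by positivity)
  have hS : 0 < sinh y := sinh_pos_iff.2 hy
  have e1 : -(q * -(ε * (cosh y / (sinh y * √(1 + p ^ 2)))))
      = ε * ((q * (cosh y / sinh y) * √(1 + p ^ 2) ^ 2) / √(1 + p ^ 2) ^ 3) := by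
    field_simp
  rw [e1, ← hW2, Real.sqrt_sq hW.le, mul_right_inj' hε, div_left_inj' (by positivity)]

/-- A rotational hypersurface is `r`-minimal iff its generating function solves the profile
equation. -/
theorem isRMinimalImmersionOn_rotParam_iff {m r : ℕ} (hr : r + 1 < m + 1) {f : ℝ → ℝ} {J : Set ℝ}
    (h : IsGenerator f J) :
    IsRMinimalImmersionOn (cylModel m) r (rotParam m f) (J ×ˢ univ) ↔
      ∀ t ∈ J, HasDerivAt (deriv f)
        (qExp (m + 1) r * (cosh (f t) / sinh (f t)) * (1 + deriv f t ^ 2)) t := by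
  have hk : ∀ t ∈ J, ∀ ε : ℝ, ε ≠ 0 →
      -(ε * (cosh (f t) / (sinh (f t) * √(1 + deriv f t ^ 2)))) ≠ 0 := by
    intro t ht ε hε
    have h1 := sinh_pos_iff.2 (h.pos t ht)
    have h2 := cosh_pos (f t)
    have h3 : 0 < √(1 + deriv f t ^ 2) := by positivity
    exact neg_ne_zero.2 (mul_ne_zero hε (by positivity))
  constructor
  · rintro ⟨-, -, -, N, hNs, hN⟩ t ht
    obtain ⟨ζ⟩ := nonempty_USphere m
    obtain ⟨ε, hε, hev⟩ := h.eventuallyEq_rotMap (p := (t, ζ)) hNs.continuousOn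
      (fun p hp => (hN p hp).1) ht
    obtain ⟨-, A, hA, hH⟩ := hN (t, ζ) ⟨ht, mem_univ _⟩
    have hdd := h.hasDerivAt_deriv ht
    rw [isShapeOperatorAt_rotParam_iff (p := (t, ζ)) (h.hasDerivAt ht) (h.pos t ht) hdd ε hev] at hA
    rw [hA, meanCurvature_diagOp_eq_zero_iff hr (hk t ht ε hε),
      mean_curvature_equation_iff (h.pos t ht) hε] at hH
    exact hdd.congr_deriv hH
  · intro hode
    have hcosh : ContDiffOn ℝ ∞ (fun t => cosh (f t)) J := contDiff_cosh.comp_contDiffOn h.smooth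
    have hsinh : ContDiffOn ℝ ∞ (fun t => sinh (f t)) J := contDiff_sinh.comp_contDiffOn h.smooth
    have h1c : ∀ t ∈ J, 1 + cosh (f t) ≠ 0 := fun t _ => by linarith [cosh_pos (f t)]
    have hW : ContDiffOn ℝ ∞ (fun t => √(1 + deriv f t ^ 2)) J :=
      (contDiffOn_const.add (h.smooth_deriv.pow 2)).sqrt fun t _ => by positivity
    have hW0 : ∀ t ∈ J, √(1 + deriv f t ^ 2) ≠ 0 := fun t _ => by positivity
    refine ⟨?_, ?_, ?_, rotMap m (normalRadial f) (normalAxial f), ?_, ?_⟩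
    · rw [rotParam_eq_rotMap]
      refine contMDiffOn_rotMap ?_ contDiffOn_id
      refine (hsinh.div (contDiffOn_const.add hcosh) h1c).congr fun t _ => tanh_half _
    · intro p _
      change ‖(rotParam m f p).1‖ < 1
      rw [rotParam_eq_rotMap, norm_rotMap_fst]
      exact abs_tanh_half_lt_one _
    · exact fun p hp => diff_rotParam_injective (h.hasDerivAt hp.1) (h.pos _ hp.1)
    · refine contMDiffOn_rotMap ?_ (h.smooth_deriv.div hW hW0).neg
      exact contDiffOn_const.div ((contDiffOn_const.add hcosh).mul hW) fun t ht =>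
        mul_ne_zero (h1c t ht) (hW0 t ht)
    · intro p hp
      refine ⟨isUnitNormalAt_rotParam (h.hasDerivAt hp.1), _,
        (isShapeOperatorAt_rotParam_iff (h.hasDerivAt hp.1) (h.pos _ hp.1) (hode _ hp.1) 1
          (Eventually.of_forall fun p' => by simp) _).2 rfl, ?_⟩
      rw [meanCurvature_diagOp_eq_zero_iff hr (hk _ hp.1 1 one_ne_zero),
        mean_curvature_equation_iff (h.pos _ hp.1) one_ne_zero]

/-! ### Coaxial spheres -/

lemma hypDist_zero_of_norm {m : ℕ} {x : EuclideanSpace ℝ (Fin (m + 1))} {s : ℝ} (hs : 0 ≤ s)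
    (hx : ‖x‖ = tanh (s / 2)) : hypDist x 0 = s := by
  have hc : 0 < 1 + cosh s := by linarith [cosh_pos s]
  have h1 : 1 + 2 * ‖x - 0‖ ^ 2
      / ((1 - ‖x‖ ^ 2) * (1 - ‖(0 : EuclideanSpace ℝ (Fin (m + 1)))‖ ^ 2)) = cosh s := by
    have h2 := conformal_factor_tanh_half s
    rw [sub_zero, norm_zero, hx, zero_pow two_ne_zero, sub_zero, mul_one, mul_div_right_comm, h2,
      tanh_half]
    have := cosh_sq s
    field_simp
    linarith
  rw [hypDist, h1, arcosh_cosh hs]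

lemma norm_rotParam_fst {m : ℕ} (f : ℝ → ℝ) (p : ℝ × USphere m) (h : 0 ≤ f p.1) :
    ‖(rotParam m f p).1‖ = tanh (f p.1 / 2) := by
  rw [rotParam_eq_rotMap, norm_rotMap_fst, abs_of_nonneg]
  rw [tanh_half]
  exact div_nonneg (sinh_nonneg_iff.2 h) (by linarith [cosh_pos (f p.1)])

lemma hypDist_rotParam {m : ℕ} (f : ℝ → ℝ) (p : ℝ × USphere m) (h : 0 ≤ f p.1) :
    hypDist (rotParam m f p).1 0 = f p.1 :=
  hypDist_zero_of_norm h (norm_rotParam_fst f p h)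

lemma rotParam_mem_ambient {m : ℕ} (f : ℝ → ℝ) (p : ℝ × USphere m) :
    rotParam m f p ∈ ambient m := by
  change ‖(rotParam m f p).1‖ < 1
  rw [rotParam_eq_rotMap, norm_rotMap_fst]
  exact abs_tanh_half_lt_one _

lemma image_rotParam_slice {m : ℕ} {f : ℝ → ℝ} {s : ℝ} (hf : 0 < f s) :
    rotParam m f '' ({s} ×ˢ univ) = coaxialSphere m (f s) s := by
  ext y
  constructor
  · rintro ⟨⟨t, ζ⟩, ⟨rfl, -⟩, rfl⟩
    exact ⟨rotParam_mem_ambient _ _, hypDist_rotParam _ _ hf.le, rfl⟩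
  · rintro ⟨hy, hd, hs⟩
    have hy : ‖y.1‖ < 1 := hy
    -- A point of Euclidean norm ρ lies at hyperbolic distance 2 artanh ρ from the centre.
    have hρ : tanh (2 * artanh ‖y.1‖ / 2) = ‖y.1‖ := by
      rw [mul_div_cancel_left₀ _ two_ne_zero, tanh_artanh ⟨by linarith [norm_nonneg y.1], hy⟩]
    have h0 : 0 ≤ artanh ‖y.1‖ := artanh_nonneg (norm_nonneg _)
    rw [hypDist_zero_of_norm (by positivity) hρ.symm] at hd
    rw [hd] at hρ
    have hpos : 0 < tanh (f s / 2) := by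
      rw [tanh_half]
      exact div_pos (sinh_pos_iff.2 hf) (by linarith [cosh_pos (f s)])
    refine ⟨(s, ⟨(tanh (f s / 2))⁻¹ • y.1, ?_⟩), ⟨rfl, mem_univ _⟩, ?_⟩
    · rw [mem_sphere_zero_iff_norm, norm_smul, norm_inv, Real.norm_of_nonneg hpos.le, ← hρ,
        inv_mul_cancel₀ hpos.ne']
    · refine Prod.ext ?_ hs.symm
      change tanh (f s / 2) • (tanh (f s / 2))⁻¹ • y.1 = y.1
      rw [smul_smul, mul_inv_cancel₀ hpos.ne', one_smul]

lemma image_rotParam_boundary {m : ℕ} {f : ℝ → ℝ} {t₀ R : ℝ} (hR : 0 < R) (h1 : f t₀ = R)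
    (h2 : f (-t₀) = R) :
    rotParam m f '' ({-t₀, t₀} ×ˢ univ) = coaxialSphere m R t₀ ∪ coaxialSphere m R (-t₀) := by
  have e1 := image_rotParam_slice (m := m) (f := f) (s := t₀) (h1 ▸ hR)
  have e2 := image_rotParam_slice (m := m) (f := f) (s := -t₀) (h2 ▸ hR)
  rw [h1] at e1
  rw [h2] at e2
  rw [← e1, ← e2, ← image_union, ← union_prod, union_comm]
  rfl

/-- One point on each end suffices: its height is ±t₀ and its distance from the axis is R, and c < d
settles the signs. -/
lemma boundary_eq {m : ℕ} {f : ℝ → ℝ} {c d t₀ R : ℝ} (hcd : c < d)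
    (hpos : ∀ t ∈ Icc c d, 0 < f t)
    (h : coaxialSphere m R t₀ ∪ coaxialSphere m R (-t₀) = rotParam m f '' ({c, d} ×ˢ univ))
    (ht₀ : 0 < t₀) : c = -t₀ ∧ d = t₀ ∧ f c = R ∧ f d = R := by
  obtain ⟨ζ⟩ := nonempty_USphere m
  have key : ∀ t ∈ ({c, d} : Set ℝ), 0 < f t → (t = t₀ ∨ t = -t₀) ∧ f t = R := by
    intro t ht hft
    have hmem : rotParam m f (t, ζ) ∈ coaxialSphere m R t₀ ∪ coaxialSphere m R (-t₀) := by
      rw [h]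
      exact ⟨(t, ζ), ⟨ht, mem_univ _⟩, rfl⟩
    have hd := hypDist_rotParam f (t, ζ) hft.le
    rcases hmem with ⟨-, h1, h2⟩ | ⟨-, h1, h2⟩
    · exact ⟨Or.inl h2, hd.symm.trans h1⟩
    · exact ⟨Or.inr h2, hd.symm.trans h1⟩
  obtain ⟨h1, h2⟩ := key c (by simp) (hpos c ⟨le_rfl, hcd.le⟩)
  obtain ⟨h3, h4⟩ := key d (by simp) (hpos d ⟨hcd.le, le_rfl⟩)
  rcases h1 with h1 | h1 <;> rcases h3 with h3 | h3
  · linarith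
  · linarith
  · exact ⟨h1, h3, h2, h4⟩
  · linarith

/-! ### Rotational hypersurfaces spanning two coaxial spheres -/

lemma catenoidPiece_eq_image {m r : ℕ} {a t₀ : ℝ} (hq : 0 < qExp (m + 1) r) (ht₀ : 0 < t₀)
    (ha : a ∈ reaching (qExp (m + 1) r) t₀) :
    catenoidPiece m r a t₀
      = rotParam m (profile (qExp (m + 1) r) a) '' (Icc (-t₀) t₀ ×ˢ univ) := by
  ext y
  constructor
  · rintro ⟨⟨p, -, rfl⟩, h⟩
    exact ⟨p, ⟨_root_.abs_le.1 h, mem_univ _⟩, rfl⟩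
  · rintro ⟨p, ⟨hp, -⟩, rfl⟩
    have hp' : |p.1| ≤ t₀ := _root_.abs_le.2 hp
    refine ⟨⟨p, ⟨?_, mem_univ _⟩, rfl⟩, hp'⟩
    rw [mem_profileDomain_iff hq ha.1]
    exact hp'.trans_lt ((reaching_iff hq ht₀).1 ha).2

lemma Icc_subset_profileDomain {q a t₀ : ℝ} (hq : 0 < q) (ht₀ : 0 < t₀)
    (ha : a ∈ reaching q t₀) : Icc (-t₀) t₀ ⊆ profileDomain q a := by
  intro t ht
  rw [mem_profileDomain_iff hq ha.1]
  exact (_root_.abs_le.2 ht).trans_lt ((reaching_iff hq ht₀).1 ha).2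

lemma isRMinimalRotational_catenoidPiece {m r : ℕ} (hr : r + 1 < m + 1) {a t₀ : ℝ}
    (hq : 0 < qExp (m + 1) r) (ht₀ : 0 < t₀) (ha : a ∈ reaching (qExp (m + 1) r) t₀) :
    IsRMinimalRotational m r (catenoidPiece m r a t₀)
      (coaxialSphere m (profile (qExp (m + 1) r) a t₀) t₀
        ∪ coaxialSphere m (profile (qExp (m + 1) r) a t₀) (-t₀)) := by
  have hsol := isProfileSolution_profile hq ha.1
  have hsub := Icc_subset_profileDomain hq ht₀ ha
  have hsub' : Ioo (-t₀) t₀ ⊆ profileDomain (qExp (m + 1) r) a := Ioo_subset_Icc_self.trans hsub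
  have hsm := contDiffOn_profile hq ha.1
  refine ⟨-t₀, t₀, profile (qExp (m + 1) r) a, by linarith, hsm.mono hsub,
    fun t ht => hsol.pos t (hsub ht), catenoidPiece_eq_image hq ht₀ ha, ?_, ?_⟩
  · refine (image_rotParam_boundary (hsol.pos _ ha.2) rfl ?_).symm
    refine (profile_eq_of_reach hq ha.1 (le_profile hq ha.1 ha.2) ?_).2
    rw [reach_profile hq ha.1 ha.2, abs_neg]
  · exact (isRMinimalImmersionOn_rotParam_iff hr
      ⟨isOpen_Ioo, hsm.mono hsub', fun t ht => hsol.pos t (hsub' ht)⟩).2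
      fun t ht => hsol.ode t (hsub' ht)

lemma isProfileSolution_comp_add {q t₁ : ℝ} {f : ℝ → ℝ} {J : Set ℝ} (hJ : IsOpen J)
    (hJc : J.OrdConnected) (h1 : t₁ ∈ J) (hpos : ∀ t ∈ J, 0 < f t)
    (hd : ∀ t ∈ J, DifferentiableAt ℝ f t)
    (hode : ∀ t ∈ J, HasDerivAt (deriv f) (q * (cosh (f t) / sinh (f t)) * (1 + deriv f t ^ 2)) t)
    (hcrit : deriv f t₁ = 0) :
    IsProfileSolution q (f t₁) ((fun t => t + t₁) ⁻¹' J) (fun t => f (t + t₁)) := by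
  have hder : deriv (fun t => f (t + t₁)) = fun t => deriv f (t + t₁) :=
    funext fun t => deriv_comp_add_const f t₁ t
  refine ⟨hJ.preimage (by fun_prop), ?_, by simpa using h1, fun t ht => hpos _ ht, ?_, ?_, ?_, ?_⟩
  · exact hJc.preimage_mono fun x y hxy => by simpa using hxy
  · exact fun t ht => ((hd _ ht).hasDerivAt.comp_add_const t t₁).differentiableAt
  · intro t ht
    rw [hder]
    exact (hode _ ht).comp_add_const t t₁
  · simp
  · rw [hder]
    simpa using hcrit

lemma exists_catenoidPiece_of_isRMinimalRotational {m r : ℕ} (hr : r + 1 < m + 1) {t₀ R : ℝ}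
    (hq : 0 < qExp (m + 1) r) (ht₀ : 0 < t₀) {M : Set (Coord m)}
    (h : IsRMinimalRotational m r M (coaxialSphere m R t₀ ∪ coaxialSphere m R (-t₀))) :
    ∃ a ∈ reaching (qExp (m + 1) r) t₀, profile (qExp (m + 1) r) a t₀ = R ∧
      M = catenoidPiece m r a t₀ := by
  obtain ⟨c, d, f, hcd, hsm, hpos, hM, hB, hmin⟩ := h
  obtain ⟨rfl, rfl, hfc, hfd⟩ := boundary_eq hcd hpos hB ht₀
  set q := qExp (m + 1) r
  have hgen : IsGenerator f (Ioo (-d) d) :=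
    ⟨isOpen_Ioo, hsm.mono Ioo_subset_Icc_self, fun t ht => hpos t (Ioo_subset_Icc_self ht)⟩
  have hode := (isRMinimalImmersionOn_rotParam_iff hr hgen).1 hmin
  -- Rolle's theorem supplies the neck; the equation is autonomous, so it can be translated to 0.
  obtain ⟨t₁, ht₁, hcrit⟩ := exists_deriv_eq_zero hcd hsm.continuousOn (hfc.trans hfd.symm)
  have hsol := isProfileSolution_comp_add isOpen_Ioo ordConnected_Ioo ht₁ hgen.pos
    (fun t ht => (hgen.hasDerivAt ht).differentiableAt) hode hcrit
  set a := f t₁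
  have ha : 0 < a := hsol.neck_pos
  -- The equation is known only in the interior; continuity carries the identity to the boundary
  -- heights.
  have hreach : EqOn (fun t => reach q a (f t)) (fun t => |t - t₁|) (Icc (-d) d) := by
    have hI : EqOn (fun t => reach q a (f t)) (fun t => |t - t₁|) (Ioo (-d) d) := by
      intro t ht
      have := hsol.reach_eq hq (t := t - t₁) (by simpa using ht)
      simpa using this
    refine hI.of_subset_closure ?_ (by fun_prop) Ioo_subset_Icc_self ?_
    · exact (continuousOn_reach_right hq ha).comp hsm.continuousOn hpos
    · rw [closure_Ioo hcd.ne]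
  have hd1 : reach q a R = |d - t₁| := by
    have := hreach (right_mem_Icc.2 hcd.le)
    simpa only [hfd] using this
  have hd2 : reach q a R = |-d - t₁| := by
    have := hreach (left_mem_Icc.2 hcd.le)
    simpa only [hfc] using this
  -- Equal radii at the two ends put both at the same distance from t₁, so the neck lies halfway.
  have hzero : t₁ = 0 := by
    rw [hd1, abs_of_pos (by linarith [ht₁.2]), abs_of_neg (by linarith [ht₁.1])] at hd2
    linarith
  have hR : 0 < R := hfd ▸ hpos d (right_mem_Icc.2 hcd.le)
  have haR : a ≤ R := by
    by_contra hlt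
    rw [reach_eq_zero hq hR (not_le.1 hlt).le, hzero, sub_zero, abs_of_pos ht₀] at hd1
    linarith
  have hle : ∀ t ∈ Icc (-d) d, a ≤ f t := by
    intro t ht
    rcases eq_or_lt_of_le ht.1 with h1 | h1
    · rwa [← h1, hfc]
    rcases eq_or_lt_of_le ht.2 with h2 | h2
    · rwa [h2, hfd]
    have := hsol.le hq (t := t - t₁) (by simpa using And.intro h1 h2)
    simpa using this
  have hprof : ∀ t ∈ Icc (-d) d, t ∈ profileDomain q a ∧ profile q a t = f t := by
    intro t ht
    refine profile_eq_of_reach hq ha (hle t ht) ?_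
    have := hreach ht
    simpa only [hzero, sub_zero] using this
  have hreaching : a ∈ reaching q d := ⟨ha, (hprof d (right_mem_Icc.2 hcd.le)).1⟩
  refine ⟨a, hreaching, (hprof d (right_mem_Icc.2 hcd.le)).2.trans hfd, ?_⟩
  rw [hM, catenoidPiece_eq_image hq ht₀ hreaching]
  refine image_congr fun p hp => ?_
  rw [rotParam, rotParam, (hprof p.1 hp.1).2]

/-- The neck size is read off as the hyperbolic radius of the slice at height 0. -/
lemma catenoidPiece_injOn {m r : ℕ} {t₀ a b : ℝ} (hq : 0 < qExp (m + 1) r) (ht₀ : 0 < t₀)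
    (ha : a ∈ reaching (qExp (m + 1) r) t₀) (hb : b ∈ reaching (qExp (m + 1) r) t₀)
    (h : catenoidPiece m r a t₀ = catenoidPiece m r b t₀) : a = b := by
  obtain ⟨ζ⟩ := nonempty_USphere m
  have h0 : (0 : ℝ) ∈ Icc (-t₀) t₀ := ⟨by linarith, ht₀.le⟩
  have hia := (isProfileSolution_profile hq ha.1).init
  have hib := (isProfileSolution_profile hq hb.1).init
  rw [catenoidPiece_eq_image hq ht₀ ha, catenoidPiece_eq_image hq ht₀ hb] at h
  have hmem : rotParam m (profile (qExp (m + 1) r) a) (0, ζ)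
      ∈ rotParam m (profile (qExp (m + 1) r) b) '' (Icc (-t₀) t₀ ×ˢ univ) :=
    h ▸ ⟨(0, ζ), ⟨h0, mem_univ _⟩, rfl⟩
  obtain ⟨⟨t, ζ'⟩, -, heq⟩ := hmem
  have ht : t = 0 := congrArg Prod.snd heq
  subst ht
  have e1 := hypDist_rotParam (profile (qExp (m + 1) r) a) (0, ζ) (hia.symm ▸ ha.1.le)
  have e2 := hypDist_rotParam (profile (qExp (m + 1) r) b) (0, ζ') (hib.symm ▸ hb.1.le)
  rw [← heq, e2, hia, hib] at e1
  exact e1.symm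

lemma qExp_pos {m r : ℕ} (hr : r + 1 < m + 1) : 0 < qExp (m + 1) r := by
  have h : (r : ℝ) + 1 < m + 1 := by exact_mod_cast hr
  rw [qExp]
  push_cast
  exact div_pos (by linarith) (by positivity)

end HypRot

/-! ### The main theorem -/

open HypRot
theorem mainTheorem7 (m r : ℕ) (hr : r + 1 < m + 1) (t₀ : ℝ) (ht₀ : 0 < t₀)
    (htT : t₀ < heightBound (qExp (m + 1) r)) :
    ∃ a₀ ∈ reaching (qExp (m + 1) r) t₀, ∃ m₀ : ℝ,
      -- `m₀` is the minimum of `a ↦ f(a, t₀)`, and it is attained exactly at `a₀`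
      m₀ = profile (qExp (m + 1) r) a₀ t₀ ∧
      (∀ a ∈ reaching (qExp (m + 1) r) t₀, a ≠ a₀ → m₀ < profile (qExp (m + 1) r) a t₀) ∧
      -- (1)
      (∀ R : ℝ, 0 < R → R < m₀ →
        ¬ ∃ M, IsRMinimalRotational m r M (coaxialSphere m R t₀ ∪ coaxialSphere m R (-t₀))) ∧
      -- (2)
      (∀ M, IsRMinimalRotational m r M (coaxialSphere m m₀ t₀ ∪ coaxialSphere m m₀ (-t₀)) ↔
        M = catenoidPiece m r a₀ t₀) ∧
      -- (3)
      (∀ R ∈ radiusRange (qExp (m + 1) r), m₀ < R →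
        (∃ a₁ ∈ reaching (qExp (m + 1) r) t₀, ∃ a₂ ∈ reaching (qExp (m + 1) r) t₀,
          a₁ < a₀ ∧ a₀ < a₂ ∧
          profile (qExp (m + 1) r) a₁ t₀ = R ∧ profile (qExp (m + 1) r) a₂ t₀ = R) ∧
        (∀ a₁ ∈ reaching (qExp (m + 1) r) t₀, ∀ a₂ ∈ reaching (qExp (m + 1) r) t₀,
          a₁ < a₀ → a₀ < a₂ →
          profile (qExp (m + 1) r) a₁ t₀ = R → profile (qExp (m + 1) r) a₂ t₀ = R →
          IsRMinimalRotational m r (catenoidPiece m r a₁ t₀)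
            (coaxialSphere m R t₀ ∪ coaxialSphere m R (-t₀)) ∧
          IsRMinimalRotational m r (catenoidPiece m r a₂ t₀)
            (coaxialSphere m R t₀ ∪ coaxialSphere m R (-t₀)) ∧
          catenoidPiece m r a₁ t₀ ≠ catenoidPiece m r a₂ t₀)) := by
  have hq := qExp_pos hr
  obtain ⟨a₀, h₀, hmin⟩ := exists_strict_min_profile hq ht₀ (reaching_nonempty hq ht₀ htT)
  refine ⟨a₀, h₀, _, rfl, hmin, ?_, ?_, ?_⟩
  -- A spanning hypersurface would be a catenoid piece whose boundary radius is a value of a ↦ f(a,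
  -- t₀), hence at least m₀.
  · rintro R - hR ⟨M, hM⟩
    obtain ⟨a, ha, rfl, -⟩ := exists_catenoidPiece_of_isRMinimalRotational hr hq ht₀ hM
    by_cases hne : a = a₀
    · exact hR.ne (by rw [hne])
    · exact (hmin a ha hne).not_gt hR
  · intro M
    constructor
    · intro hM
      obtain ⟨a, ha, heq, rfl⟩ := exists_catenoidPiece_of_isRMinimalRotational hr hq ht₀ hM
      by_cases hne : a = a₀
      · rw [hne]
      · exact absurd heq (hmin a ha hne).ne'
    · rintro rfl
      exact isRMinimalRotational_catenoidPiece hr hq ht₀ h₀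
  · intro R _ hR
    constructor
    · obtain ⟨⟨a₁, h1, h1', e1⟩, a₂, h2, h2', e2⟩ := exists_profile_eq_of_lt hq ht₀ h₀ hR
      exact ⟨a₁, h1, a₂, h2, h1', h2', e1, e2⟩
    · rintro a₁ h1 a₂ h2 hlt1 hlt2 rfl e2
      refine ⟨isRMinimalRotational_catenoidPiece hr hq ht₀ h1, ?_, fun heq => ?_⟩
      · rw [← e2]
        exact isRMinimalRotational_catenoidPiece hr hq ht₀ h2
      · exact (hlt1.trans hlt2).ne (catenoidPiece_injOn hq ht₀ h1 h2 heq)
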